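/- Let $\lambda_1,\lambda_2\in\mathbb R$ with $k:=\lambda_1/\lambda_2<0$, put $\lambda_3=-\lambda_1$, $\lambda_4=-\lambda_2$, and let $a\in\mathbb C$. Let $\operatorname{sn},\operatorname{cn},\operatorname{dn}$ be the Jacobi elliptic functions of modulus $k$, meromorphic on $\mathbb C$. Call $c:\mathbb Z\to\mathbb C$ admissible if $c(n+2)=c(n)$ for all $n$, $$\operatorname{sn}(c(2n))=\frac{e^{a}}{\sqrt{-k}},\qquad \operatorname{sn}(c(2n+1))=\frac{e^{-a}}{\sqrt{-k}},$$ and, with $c_0=c(0)$, $c_1=c(1)$, $$\operatorname{cn}(c_0)\operatorname{dn}(c_0)+|k|\operatorname{sn}^2(c_0)\operatorname{cn}(c_1)\operatorname{dn}(c_1)=0 .$$ If $k\neq-1$ or $e^{2a}\ne 1$, then an admissible $c$ exists. Let $c$ be any admissible function, and for $n\in\mathbb Z$, $t\in\mathbb R$ put $\varkappa(n,t)=\lambda_2t+c(n)$, $\gamma_n(t)=\lambda_1\operatorname{sn}\varkappa(n,t)$ and $$u_n(t)=\frac{\lambda_2}{2}\left(|k|\operatorname{sn}\varkappa(n,t)+\frac{\operatorname{cn}\varkappa(n,t)\operatorname{dn}\varkappa(n,t)+1}{\operatorname{sn}\varkappa(n,t)}\right),\qquad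 v_n(t)=-\frac{\lambda_2}{\operatorname{sn}\varkappa(n,t)} .$$ (1) $u_{n+2}=u_n$ and $v_{n+2}=v_n$. For all $n,t$ such that $\varkappa(n,t)$ is neither a zero nor a pole of $\operatorname{sn}$, $$u_{n,t}=u_n(u_{n-1}-u_{n+1}+v_n-v_{n+1}),\qquad v_{n,t}=v_n(u_{n-1}-u_n).$$ Moreover $\gamma_{n,t}^2=\prod_{i=1}^4(\gamma_n-\lambda_i)$, $\gamma_{n+1}=-\lambda_1\lambda_2/\gamma_n$, $v_n=-\lambda_1\lambda_2/\gamma_n$ and $u_n=-\frac12\left(\gamma_n-\frac{\gamma_{n,t}}{\gamma_n}-\frac{\lambda_1\lambda_2}{\gamma_n}\right)+\frac14\sum_{i=1}^4\lambda_i$ there. (2) Let in addition $k\ne-1$, $h>0$, $C\in\mathbb C$, and let $U\subset\mathbb R$ be an open set on which $\varkappa(0,t)$ is neither a zero nor a pole of $\operatorname{sn}$. Define $x_n(t)$ on $U$ by $$x_0=-\frac th+C+\frac12\log\bigl(1+|k|\operatorname{sn}^2\varkappa(0,t)+\operatorname{cn}\varkappa(0,t)\operatorname{dn}\varkappa(0,t)\bigr),$$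 $$x_{2n}=x_0-n\Bigl(\log\frac{u_0u_1}{v_0v_1}+4\log\frac1h\Bigr),\qquad x_{2n+1}=x_{2n}-\Bigl(\log\frac{u_0}{v_0}+2\log\frac1h\Bigr),\qquad n\in\mathbb Z,$$ where the logarithm in $x_0$ and $\log(u_0/v_0)$ are any branches continuous on $U$, and $\log\frac{u_0u_1}{v_0v_1}$ is the principal value. Then for all $n\in\mathbb Z$ and $t\in U$: $e^{x_n-x_{n+1}}=\frac{u_n}{h^2v_n}$, $x_{n,t}=u_n+v_n-\frac1h$, the denominators below do not vanish, $$u_n=\frac{h(1+hx_{n,t})e^{x_n-x_{n+1}}}{1+h^2e^{x_n-x_{n+1}}},\qquad v_n=\frac{1+hx_{n,t}}{h(1+h^2e^{x_n-x_{n+1}})},$$ and $x_n$ solves the relativistic Toda lattice $$x_{n,tt}=(1+hx_{n,t})(1+hx_{n-1,t})\frac{e^{x_{n-1}-x_n}}{1+h^2e^{x_{n-1}-x_n}}-(1+hx_{n,t})(1+hx_{n+1,t})\frac{e^{x_n-x_{n+1}}}{1+h^2e^{x_n-x_{n+1}}} .$$ -/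

import Mathlib

noncomputable section

/-- The incomplete elliptic integral of the first kind
`F(φ, k) = ∫_0^φ dθ / √(1 - k² sin² θ)`. -/
def ellipticF (k φ : ℝ) : ℝ :=
  ∫ θ in (0 : ℝ)..φ, 1 / Real.sqrt (1 - k ^ 2 * Real.sin θ ^ 2)

/-- The Jacobi amplitude `am(u, k)` for a real modulus with `|k| ≤ 1`. For `|k| < 1` the map
`φ ↦ F(φ, k)` is a bijection of `ℝ`, and the amplitude is its inverse. For `|k| = 1` the integral
is inverted on `(-π/2, π/2)`, which gives the Gudermannian `arcsin (tanh u)`. -/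
def jacobiAm (k u : ℝ) : ℝ :=
  if |k| < 1 then Function.invFun (ellipticF k) u else Real.arcsin (Real.tanh u)

/-- `sn(u, k)` for real `u` and `|k| ≤ 1`. -/
def realSn (k u : ℝ) : ℝ := Real.sin (jacobiAm k u)

/-- `cn(u, k)` for real `u` and `|k| ≤ 1`. -/
def realCn (k u : ℝ) : ℝ := Real.cos (jacobiAm k u)

/-- `dn(u, k)` for real `u` and `|k| ≤ 1`. -/
def realDn (k u : ℝ) : ℝ := Real.sqrt (1 - k ^ 2 * realSn k u ^ 2)

/-- The complementary modulus `k' = √(1 - k²)`. -/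
def coModulus (k : ℝ) : ℝ := Real.sqrt (1 - k ^ 2)

/-- The common denominator in the formulas for the Jacobi functions of a complex argument:
`cn²(y, k') + k² sn²(x, k) sn²(y, k')` at `z = x + i y`. For `|k| ≤ 1`, its zeros are the poles. -/
def jacobiDen (k : ℝ) (z : ℂ) : ℝ :=
  realCn (coModulus k) z.im ^ 2 + k ^ 2 * realSn k z.re ^ 2 * realSn (coModulus k) z.im ^ 2

/-- `sn(z, k)` for complex `z = x + i y` and `|k| ≤ 1`, through the imaginary transformation
and the addition theorem. -/
def snAux (k : ℝ) (z : ℂ) : ℂ :=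
  ((realSn k z.re * realDn (coModulus k) z.im : ℝ) +
    Complex.I * (realCn k z.re * realDn k z.re * realSn (coModulus k) z.im *
      realCn (coModulus k) z.im : ℝ)) / (jacobiDen k z : ℝ)

/-- `cn(z, k)` for complex `z` and `|k| ≤ 1`. -/
def cnAux (k : ℝ) (z : ℂ) : ℂ :=
  ((realCn k z.re * realCn (coModulus k) z.im : ℝ) -
    Complex.I * (realSn k z.re * realDn k z.re * realSn (coModulus k) z.im *
      realDn (coModulus k) z.im : ℝ)) / (jacobiDen k z : ℝ)

/-- `dn(z, k)` for complex `z` and `|k| ≤ 1`. -/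
def dnAux (k : ℝ) (z : ℂ) : ℂ :=
  ((realDn k z.re * realCn (coModulus k) z.im * realDn (coModulus k) z.im : ℝ) -
    Complex.I * (k ^ 2 * realSn k z.re * realCn k z.re * realSn (coModulus k) z.im : ℝ)) /
    (jacobiDen k z : ℝ)

/-- The Jacobi elliptic sine `sn(z, k)`, for complex `z` and any real modulus `k`. The case
`|k| > 1` is given by the reciprocal modulus transformation. At a pole the value is `0`. -/
def jacobiSn (k : ℝ) (z : ℂ) : ℂ :=
  if |k| ≤ 1 then snAux k z else snAux |k|⁻¹ (|k| * z) / |k|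

/-- The Jacobi elliptic cosine `cn(z, k)`, for complex `z` and any real modulus `k`. -/
def jacobiCn (k : ℝ) (z : ℂ) : ℂ :=
  if |k| ≤ 1 then cnAux k z else dnAux |k|⁻¹ (|k| * z)

/-- The delta amplitude `dn(z, k)`, for complex `z` and any real modulus `k`. -/
def jacobiDn (k : ℝ) (z : ℂ) : ℂ :=
  if |k| ≤ 1 then dnAux k z else cnAux |k|⁻¹ (|k| * z)

/-- The lattice
`u_{n,t} = u_n (u_{n-1} - u_{n+1} + v_n - v_{n+1})`, `v_{n,t} = v_n (u_{n-1} - u_n)`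
holds at the site `n` and the time `t`. -/
def SolvesRTLAt (u v : ℤ → ℝ → ℂ) (n : ℤ) (t : ℝ) : Prop :=
  HasDerivAt (u n) (u n t * (u (n - 1) t - u (n + 1) t + v n t - v (n + 1) t)) t ∧
  HasDerivAt (v n) (v n t * (u (n - 1) t - u n t)) t

/-- The relativistic Toda lattice, as a second order equation for `x_n`,
```
x_n'' = (1+h x_n')(1+h x_{n-1}') e^{x_{n-1}-x_n} / (1+h² e^{x_{n-1}-x_n})
        - (1+h x_n')(1+h x_{n+1}') e^{x_n-x_{n+1}} / (1+h² e^{x_n-x_{n+1}}),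
```
holds at the site `n` and the time `t`, all derivatives existing and no denominator vanishing. -/
def SolvesRuijsenaarsTodaAt (h : ℝ) (x : ℤ → ℝ → ℂ) (n : ℤ) (t : ℝ) : Prop :=
  DifferentiableAt ℝ (x (n - 1)) t ∧ DifferentiableAt ℝ (x n) t ∧
  DifferentiableAt ℝ (x (n + 1)) t ∧
  1 + (h : ℂ) ^ 2 * Complex.exp (x (n - 1) t - x n t) ≠ 0 ∧
  1 + (h : ℂ) ^ 2 * Complex.exp (x n t - x (n + 1) t) ≠ 0 ∧
  HasDerivAt (deriv (x n))
    ((1 + h * deriv (x n) t) * (1 + h * deriv (x (n - 1)) t) *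
        (Complex.exp (x (n - 1) t - x n t) /
          (1 + (h : ℂ) ^ 2 * Complex.exp (x (n - 1) t - x n t))) -
      (1 + h * deriv (x n) t) * (1 + h * deriv (x (n + 1)) t) *
        (Complex.exp (x n t - x (n + 1) t) /
          (1 + (h : ℂ) ^ 2 * Complex.exp (x n t - x (n + 1) t)))) t

/-- `(u, v)` and `x` are related at `n`, `t` by the substitution
`u_n = h (1+h x_n') e^{x_n-x_{n+1}} / (1+h² e^{x_n-x_{n+1}})`,
`v_n = (1+h x_n') / (h (1+h² e^{x_n-x_{n+1}}))`. -/
def SubstitutionAt (h : ℝ) (x u v : ℤ → ℝ → ℂ) (n : ℤ) (t : ℝ) : Prop :=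
  DifferentiableAt ℝ (x n) t ∧
  1 + (h : ℂ) ^ 2 * Complex.exp (x n t - x (n + 1) t) ≠ 0 ∧
  u n t = h * (1 + h * deriv (x n) t) * Complex.exp (x n t - x (n + 1) t) /
    (1 + (h : ℂ) ^ 2 * Complex.exp (x n t - x (n + 1) t)) ∧
  v n t = (1 + h * deriv (x n) t) /
    (h * (1 + (h : ℂ) ^ 2 * Complex.exp (x n t - x (n + 1) t)))

/-- The admissible phases `c(n)`: 2-periodic, with prescribed values of `sn`, and with the
relation between the values of `cn · dn`. -/
structure IsPhase (k : ℝ) (a : ℂ) (c : ℤ → ℂ) : Prop where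
  periodic : ∀ n, c (n + 2) = c n
  sn_even : ∀ n, jacobiSn k (c (2 * n)) = Complex.exp a / (Real.sqrt (-k) : ℝ)
  sn_odd : ∀ n, jacobiSn k (c (2 * n + 1)) = Complex.exp (-a) / (Real.sqrt (-k) : ℝ)
  cn_dn : jacobiCn k (c 0) * jacobiDn k (c 0) +
    |k| * jacobiSn k (c 0) ^ 2 * (jacobiCn k (c 1) * jacobiDn k (c 1)) = 0

/-- `ϰ(n, t) = λ₂ t + c(n)`. -/
def phaseArg (l2 : ℝ) (c : ℤ → ℂ) (n : ℤ) (t : ℝ) : ℂ := l2 * t + c n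

/-- `γ_n(t) = λ₁ sn(ϰ(n,t))`, with modulus `k = λ₁ / λ₂`. -/
def periodicGamma (l1 l2 : ℝ) (c : ℤ → ℂ) (n : ℤ) (t : ℝ) : ℂ :=
  l1 * jacobiSn (l1 / l2) (phaseArg l2 c n t)

/-- `u_n(t) = (λ₂/2) (|k| sn ϰ + (cn ϰ dn ϰ + 1) / sn ϰ)`. -/
def periodicU (l1 l2 : ℝ) (c : ℤ → ℂ) (n : ℤ) (t : ℝ) : ℂ :=
  l2 / 2 * (|l1 / l2| * jacobiSn (l1 / l2) (phaseArg l2 c n t) +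
    (jacobiCn (l1 / l2) (phaseArg l2 c n t) * jacobiDn (l1 / l2) (phaseArg l2 c n t) + 1) /
      jacobiSn (l1 / l2) (phaseArg l2 c n t))

/-- `v_n(t) = -λ₂ / sn ϰ`. -/
def periodicV (l1 l2 : ℝ) (c : ℤ → ℂ) (n : ℤ) (t : ℝ) : ℂ :=
  -l2 / jacobiSn (l1 / l2) (phaseArg l2 c n t)

end

/-!
Time moves only the real part of the argument `λ₂ t + c n`, so everything reduces to the real
functions `sn`, `cn`, `dn` and to algebra. The real functions come from the amplitude, whose
equation `am' = dn` is the inverse function rule (`hasDerivAt_jacobiAm`). At `x + i y` the three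
functions are rational in six numbers, `s, c, d` (modulus `k`, at `x`) and `σ, χ, δ`
(complementary modulus, at `y`), which are collected in `JacobiData`. Differentiating in `x` gives
the classical derivatives along horizontal lines.

The central point is that neighbouring sites satisfy `|k| sn ϰ_n sn ϰ_{n+1} = 1` at all times,
although admissibility says so only at time zero. Replacing `(σ, χ, δ)` by `(χ, -|k| σ, |k|) / δ`
is the translation by `i K'`; it turns `sn` into `1 / (|k| sn)` and `cn dn` into
`-cn dn / (|k| sn²)` (`JacobiData.shift_sn`, `JacobiData.shift_cn_mul_dn`). On the other hand the
pair `(sn, cn dn)` determines the data up to periods (`JacobiData.equiv_of_sn_eq`), by the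
identities `|1 ± sn| = (1 ± s δ) / √den` and `|1 ± k sn| = (δ ± k s) / √den`. Hence `c 1` is
`c 0 + i K'` up to periods, and real translates stay related, also across poles
(`snAux_add_of_snAux_mul_eq`).

Solving the same identities for `s` and `δ` shows that every point of the curve
`p² = (1 - w²) (1 - k² w²)` is a value of `(sn, cn dn)` if `|k| ≠ 1` (`JacobiData.exists_sn_eq`).
If `|k| = 1` then `sn = tanh`, which omits exactly `±1`. This gives admissible phases
(`exists_isPhase`); moduli with `|k| > 1` are reduced to `1 / |k|`.

Given the relation between neighbouring sites, the lattice for `u` and `v` is an algebraic identity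
modulo `p² = (1 - w²) (1 - k² w²)`. The product `u₀ u₁ / (v₀ v₁)` is the constant
`(1 + |k|)² / (4 |k|)`, so its logarithm does not contribute to the derivative of `x_n`, and
`u_n + v_n` does not vanish because `k ≠ -1`. The second order equation then follows from the first
order lattice alone (`solvesRuijsenaarsTodaAt_of_solvesRTLAt`).
-/

/-! ### The real Jacobi functions -/

theorem one_sub_sq_mul_sin_sq_pos {k : ℝ} (hk : |k| < 1) (θ : ℝ) :
    0 < 1 - k ^ 2 * Real.sin θ ^ 2 := by
  have h1 : k ^ 2 < 1 := (sq_lt_one_iff_abs_lt_one k).2 hk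
  nlinarith [Real.sin_sq_le_one θ, sq_nonneg (Real.sin θ), sq_nonneg k]

theorem hasDerivAt_ellipticF {k : ℝ} (hk : |k| < 1) (φ : ℝ) :
    HasDerivAt (ellipticF k) (1 / Real.sqrt (1 - k ^ 2 * Real.sin φ ^ 2)) φ := by
  have hc : Continuous fun θ : ℝ => 1 / Real.sqrt (1 - k ^ 2 * Real.sin θ ^ 2) := by
    refine continuous_const.div (by fun_prop) fun θ => ?_
    exact (Real.sqrt_pos.2 (one_sub_sq_mul_sin_sq_pos hk θ)).ne'
  exact intervalIntegral.integral_hasDerivAt_right (hc.intervalIntegrable _ _)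
    hc.stronglyMeasurable.stronglyMeasurableAtFilter hc.continuousAt

theorem strictMono_ellipticF {k : ℝ} (hk : |k| < 1) : StrictMono (ellipticF k) := by
  refine strictMono_of_deriv_pos fun φ => ?_
  rw [(hasDerivAt_ellipticF hk φ).deriv]
  have := Real.sqrt_pos.2 (one_sub_sq_mul_sin_sq_pos hk φ)
  positivity

/-- The integrand of `F` is at least `1`, so `F` is unbounded in both directions. -/
theorem surjective_ellipticF {k : ℝ} (hk : |k| < 1) : Function.Surjective (ellipticF k) := by
  have hd : Differentiable ℝ (ellipticF k) := fun φ => (hasDerivAt_ellipticF hk φ).differentiableAt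
  have hmono : Monotone fun φ => ellipticF k φ - φ := by
    refine monotone_of_deriv_nonneg (hd.sub differentiable_id) fun φ => ?_
    have h := (hasDerivAt_ellipticF hk φ).sub (hasDerivAt_id φ)
    have h' : deriv (fun φ => ellipticF k φ - φ) φ = _ := h.deriv
    rw [h', sub_nonneg, le_div_iff₀ (Real.sqrt_pos.2 (one_sub_sq_mul_sin_sq_pos hk φ)), one_mul]
    refine Real.sqrt_le_one.2 ?_
    nlinarith [sq_nonneg (k * Real.sin φ)]
  have h0 : ellipticF k 0 = 0 := by simp [ellipticF]
  refine hd.continuous.surjective ?_ ?_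
  · refine Filter.tendsto_atTop_mono' _ ?_ Filter.tendsto_id
    filter_upwards [Filter.eventually_ge_atTop 0] with φ hφ
    have := hmono hφ
    simp only [h0] at this
    simp only [id]; linarith
  · refine Filter.tendsto_atBot_mono' _ ?_ Filter.tendsto_id
    filter_upwards [Filter.eventually_le_atBot 0] with φ hφ
    have := hmono hφ
    simp only [h0] at this
    simp only [id]; linarith

theorem jacobiAm_ellipticF {k : ℝ} (hk : |k| < 1) (φ : ℝ) : jacobiAm k (ellipticF k φ) = φ := by
  rw [jacobiAm, if_pos hk]
  exact Function.leftInverse_invFun (strictMono_ellipticF hk).injective φ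

theorem ellipticF_jacobiAm {k : ℝ} (hk : |k| < 1) (u : ℝ) : ellipticF k (jacobiAm k u) = u := by
  rw [jacobiAm, if_pos hk]
  exact Function.rightInverse_invFun (surjective_ellipticF hk) u

theorem continuous_jacobiAm {k : ℝ} (hk : |k| < 1) : Continuous (jacobiAm k) := by
  have he : jacobiAm k =
      ((strictMono_ellipticF hk).orderIsoOfSurjective _ (surjective_ellipticF hk)).symm := by
    funext u
    rw [OrderIso.eq_symm_apply]
    exact ellipticF_jacobiAm hk u
  rw [he]
  exact OrderIso.continuous _

theorem realSn_of_abs_eq_one {k : ℝ} (hk : |k| = 1) (u : ℝ) : realSn k u = Real.tanh u := by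
  rw [realSn, jacobiAm, if_neg hk.not_lt]
  exact Real.sin_arcsin (Real.neg_one_lt_tanh u).le (Real.tanh_lt_one u).le

theorem sqrt_one_sub_tanh_sq (u : ℝ) : Real.sqrt (1 - Real.tanh u ^ 2) = 1 / Real.cosh u := by
  have hc := Real.cosh_pos u
  rw [Real.sqrt_eq_iff_mul_self_eq_of_pos (by positivity), Real.tanh_eq_sinh_div_cosh]
  field_simp
  linarith [Real.cosh_sq u]

theorem realCn_of_abs_eq_one {k : ℝ} (hk : |k| = 1) (u : ℝ) :
    realCn k u = 1 / Real.cosh u := by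
  rw [realCn, jacobiAm, if_neg hk.not_lt, Real.cos_arcsin, sqrt_one_sub_tanh_sq]

theorem realDn_of_abs_eq_one {k : ℝ} (hk : |k| = 1) (u : ℝ) :
    realDn k u = 1 / Real.cosh u := by
  have h2 : k ^ 2 = 1 := by rw [← sq_abs, hk, one_pow]
  rw [realDn, realSn_of_abs_eq_one hk, h2, one_mul, sqrt_one_sub_tanh_sq]

theorem one_sub_sq_mul_realSn_sq_pos {k : ℝ} (hk : |k| ≤ 1) (u : ℝ) :
    0 < 1 - k ^ 2 * realSn k u ^ 2 := by
  rcases hk.lt_or_eq with h | h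
  · exact one_sub_sq_mul_sin_sq_pos h _
  · have h2 : k ^ 2 = 1 := by rw [← sq_abs, h, one_pow]
    rw [realSn_of_abs_eq_one h, h2]
    linarith [Real.tanh_sq_lt_one u]

theorem realDn_pos {k : ℝ} (hk : |k| ≤ 1) (u : ℝ) : 0 < realDn k u :=
  Real.sqrt_pos.2 (one_sub_sq_mul_realSn_sq_pos hk u)

theorem realDn_sq {k : ℝ} (hk : |k| ≤ 1) (u : ℝ) :
    realDn k u ^ 2 = 1 - k ^ 2 * realSn k u ^ 2 :=
  Real.sq_sqrt (one_sub_sq_mul_realSn_sq_pos hk u).le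

theorem realSn_sq_add_realCn_sq (k u : ℝ) : realSn k u ^ 2 + realCn k u ^ 2 = 1 :=
  Real.sin_sq_add_cos_sq _

theorem hasDerivAt_realTanh (u : ℝ) : HasDerivAt Real.tanh (1 / Real.cosh u ^ 2) u := by
  have h := (Real.hasDerivAt_sinh u).div (Real.hasDerivAt_cosh u) (Real.cosh_pos u).ne'
  have he : Real.tanh = fun x => Real.sinh x / Real.cosh x := by
    funext x; exact Real.tanh_eq_sinh_div_cosh x
  rw [he]
  refine h.congr_deriv ?_
  congr 1
  linarith [Real.cosh_sq u]

/-- The amplitude solves `am' = dn`. -/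
theorem hasDerivAt_jacobiAm {k : ℝ} (hk : |k| ≤ 1) (u : ℝ) :
    HasDerivAt (jacobiAm k) (realDn k u) u := by
  rcases hk.lt_or_eq with h | h
  · have hp := one_sub_sq_mul_sin_sq_pos h (jacobiAm k u)
    have hF := hasDerivAt_ellipticF h (jacobiAm k u)
    have := HasDerivAt.of_local_left_inverse (continuous_jacobiAm h).continuousAt hF
      (by have := Real.sqrt_pos.2 hp; positivity)
      (Filter.Eventually.of_forall fun y => ellipticF_jacobiAm h y)
    simpa [realDn, realSn] using this
  · have ht := hasDerivAt_realTanh u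
    have ha := (Real.hasDerivAt_arcsin (Real.neg_one_lt_tanh u).ne'
      (Real.tanh_lt_one u).ne).comp u ht
    have he : jacobiAm k = Real.arcsin ∘ Real.tanh := by
      funext v; rw [jacobiAm, if_neg h.not_lt]; rfl
    rw [he, realDn_of_abs_eq_one h]
    refine ha.congr_deriv ?_
    rw [sqrt_one_sub_tanh_sq]
    have := Real.cosh_pos u
    field_simp

theorem hasDerivAt_realSn {k : ℝ} (hk : |k| ≤ 1) (u : ℝ) :
    HasDerivAt (realSn k) (realCn k u * realDn k u) u :=
  (hasDerivAt_jacobiAm hk u).sin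

theorem hasDerivAt_realCn {k : ℝ} (hk : |k| ≤ 1) (u : ℝ) :
    HasDerivAt (realCn k) (-(realSn k u * realDn k u)) u := by
  have := (hasDerivAt_jacobiAm hk u).cos
  rwa [neg_mul] at this

theorem hasDerivAt_realDn {k : ℝ} (hk : |k| ≤ 1) (u : ℝ) :
    HasDerivAt (realDn k) (-(k ^ 2 * realSn k u * realCn k u)) u := by
  have h := (((hasDerivAt_realSn hk u).pow 2).const_mul (k ^ 2)).const_sub 1
  have := h.sqrt (one_sub_sq_mul_realSn_sq_pos hk u).ne'
  refine HasDerivAt.congr_deriv (f := realDn k) this ?_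
  change _ / (2 * realDn k u) = _
  have := realDn_pos hk u
  field_simp
  push_cast
  ring

/-- For `|k| < 1` the pair `(sn, cn)` runs through the whole unit circle. -/
theorem exists_realSn_realCn_eq {k : ℝ} (hk : |k| < 1) {s c : ℝ} (h : s ^ 2 + c ^ 2 = 1) :
    ∃ u, realSn k u = s ∧ realCn k u = c := by
  have hn : ‖(⟨c, s⟩ : ℂ)‖ = 1 := by
    rw [Complex.norm_def, Complex.normSq_mk, Real.sqrt_eq_one]; linarith
  have hne : (⟨c, s⟩ : ℂ) ≠ 0 := by rw [← norm_ne_zero_iff, hn]; exact one_ne_zero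
  refine ⟨ellipticF k (Complex.arg ⟨c, s⟩), ?_, ?_⟩
  · rw [realSn, jacobiAm_ellipticF hk, Complex.sin_arg, hn, div_one]
  · rw [realCn, jacobiAm_ellipticF hk, Complex.cos_arg hne, hn, div_one]

/-- Quasi-periodicity of the elliptic integral: its integrand has period `2π`. -/
theorem ellipticF_add_two_pi_mul {k : ℝ} (hk : |k| < 1) (n : ℤ) (φ : ℝ) :
    ellipticF k (φ + 2 * Real.pi * n) = ellipticF k φ + ellipticF k (2 * Real.pi * n) := by
  have hd : ∀ θ, HasDerivAt (fun θ => ellipticF k (θ + 2 * Real.pi * n) - ellipticF k θ) 0 θ := by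
    intro θ
    have h := ((hasDerivAt_ellipticF hk (θ + 2 * Real.pi * n)).comp_add_const θ _).sub
      (hasDerivAt_ellipticF hk θ)
    have hs : Real.sin (θ + 2 * Real.pi * n) = Real.sin θ := by
      rw [mul_comm (2 * Real.pi)]; exact Real.sin_add_int_mul_two_pi θ n
    rw [hs, sub_self] at h
    exact h
  have := is_const_of_deriv_eq_zero (fun θ => (hd θ).differentiableAt) (fun θ => (hd θ).deriv) φ 0
  have h0 : ellipticF k 0 = 0 := by simp [ellipticF]
  simp only [zero_add, h0] at this
  linarith

/-- The pair `(sn, cn)` at one real point determines it at all translates: the two points differ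
by a period, or coincide if `|k| = 1`. -/
theorem realSn_realCn_add_eq {k : ℝ} (hk : |k| ≤ 1) {x y : ℝ} (hs : realSn k x = realSn k y)
    (hc : realCn k x = realCn k y) (t : ℝ) :
    realSn k (t + x) = realSn k (t + y) ∧ realCn k (t + x) = realCn k (t + y) := by
  rcases hk.lt_or_eq with h | h
  · obtain ⟨n, hn⟩ := Real.Angle.angle_eq_iff_two_pi_dvd_sub.1 (Real.Angle.cos_sin_inj hc hs)
    have hn' : jacobiAm k x = jacobiAm k y + 2 * Real.pi * n := by linarith
    have hx : x = y + ellipticF k (2 * Real.pi * n) := by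
      rw [← ellipticF_jacobiAm h x, hn', ellipticF_add_two_pi_mul h, ellipticF_jacobiAm h]
    have ht : jacobiAm k (t + x) = jacobiAm k (t + y) + 2 * Real.pi * n := by
      rw [← jacobiAm_ellipticF h (jacobiAm k (t + y) + 2 * Real.pi * n),
        ellipticF_add_two_pi_mul h, ellipticF_jacobiAm h, hx, add_assoc]
    rw [realSn, realCn, ht, mul_comm (2 * Real.pi)]
    exact ⟨Real.sin_add_int_mul_two_pi _ n, Real.cos_add_int_mul_two_pi _ n⟩
  · rw [realSn_of_abs_eq_one h, realSn_of_abs_eq_one h] at hs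
    rw [Real.tanh_injective hs]
    exact ⟨rfl, rfl⟩

theorem coModulus_sq {k : ℝ} (hk : |k| ≤ 1) : coModulus k ^ 2 = 1 - k ^ 2 :=
  Real.sq_sqrt (sub_nonneg.2 ((sq_le_one_iff_abs_le_one k).2 hk))

theorem abs_coModulus_le_one (k : ℝ) : |coModulus k| ≤ 1 := by
  rw [coModulus, abs_of_nonneg (Real.sqrt_nonneg _)]
  exact Real.sqrt_le_one.2 (by nlinarith [sq_nonneg k])

theorem abs_coModulus_lt_one {k : ℝ} (hk : k ≠ 0) : |coModulus k| < 1 := by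
  rw [coModulus, abs_of_nonneg (Real.sqrt_nonneg _), Real.sqrt_lt' one_pos]
  have : 0 < k ^ 2 := by positivity
  linarith

/-! ### Algebraic data behind the Jacobi functions of a complex argument -/

/-- The values `s, c, d` of `sn, cn, dn` with modulus `k` at a real point `x`, and the values
`σ, χ, δ` of `sn, cn, dn` with the complementary modulus at a real point `y`, subject only to the
algebraic relations between them. They determine the Jacobi functions at `x + i y`. -/
structure JacobiData (k : ℝ) where
  (s c d σ χ δ : ℝ)
  s_sq_add_c_sq : s ^ 2 + c ^ 2 = 1
  d_pos : 0 < d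
  d_sq : d ^ 2 = 1 - k ^ 2 * s ^ 2
  σ_sq_add_χ_sq : σ ^ 2 + χ ^ 2 = 1
  δ_pos : 0 < δ
  δ_sq : δ ^ 2 = 1 - (1 - k ^ 2) * σ ^ 2

namespace JacobiData

variable {k : ℝ} (P Q : JacobiData k)

/-- The common denominator of `sn`, `cn`, `dn`. -/
def den : ℝ := P.χ ^ 2 + k ^ 2 * P.s ^ 2 * P.σ ^ 2

/-- The value of `sn` at `x + i y`. -/
noncomputable def sn : ℂ :=
  ((P.s * P.δ : ℝ) + Complex.I * (P.c * P.d * P.σ * P.χ : ℝ)) / (P.den : ℝ)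

/-- The value of `cn` at `x + i y`. -/
noncomputable def cn : ℂ :=
  ((P.c * P.χ : ℝ) - Complex.I * (P.s * P.d * P.σ * P.δ : ℝ)) / (P.den : ℝ)

/-- The value of `dn` at `x + i y`. -/
noncomputable def dn : ℂ :=
  ((P.d * P.χ * P.δ : ℝ) - Complex.I * (k ^ 2 * P.s * P.c * P.σ : ℝ)) / (P.den : ℝ)

theorem den_nonneg : 0 ≤ P.den := by unfold den; positivity

theorem den_ne_zero_of_sn_ne_zero (h : P.sn ≠ 0) : P.den ≠ 0 := by
  intro h0
  apply h
  rw [sn, h0, Complex.ofReal_zero, div_zero]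

theorem sn_sq_add_cn_sq (h : P.den ≠ 0) : P.sn ^ 2 + P.cn ^ 2 = 1 := by
  have hD : (P.den : ℂ) ≠ 0 := Complex.ofReal_ne_zero.2 h
  obtain ⟨s, c, d, σ, χ, δ, h1, h2, h3, h4, h5, h6⟩ := P
  rw [sn, cn, div_pow, div_pow, ← add_div, div_eq_one_iff_eq (pow_ne_zero 2 hD)]
  have g1 : (s : ℂ) ^ 2 + c ^ 2 = 1 := by exact_mod_cast h1
  have g3 : (d : ℂ) ^ 2 = 1 - k ^ 2 * s ^ 2 := by exact_mod_cast h3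
  have g4 : (σ : ℂ) ^ 2 + χ ^ 2 = 1 := by exact_mod_cast h4
  have g6 : (δ : ℂ) ^ 2 = 1 - (1 - k ^ 2) * σ ^ 2 := by exact_mod_cast h6
  have hI := Complex.I_sq
  simp only [den]
  push_cast
  clear hD h h1 h2 h3 h4 h5 h6
  grind

theorem dn_sq (h : P.den ≠ 0) : P.dn ^ 2 = 1 - k ^ 2 * P.sn ^ 2 := by
  have hD : (P.den : ℂ) ≠ 0 := Complex.ofReal_ne_zero.2 h
  rw [eq_sub_iff_add_eq]
  obtain ⟨s, c, d, σ, χ, δ, h1, h2, h3, h4, h5, h6⟩ := P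
  rw [sn, dn, div_pow, div_pow, ← mul_div_assoc, ← add_div, div_eq_one_iff_eq (pow_ne_zero 2 hD)]
  have g1 : (s : ℂ) ^ 2 + c ^ 2 = 1 := by exact_mod_cast h1
  have g3 : (d : ℂ) ^ 2 = 1 - k ^ 2 * s ^ 2 := by exact_mod_cast h3
  have g4 : (σ : ℂ) ^ 2 + χ ^ 2 = 1 := by exact_mod_cast h4
  have g6 : (δ : ℂ) ^ 2 = 1 - (1 - k ^ 2) * σ ^ 2 := by exact_mod_cast h6
  have hI := Complex.I_sq
  simp only [den]
  push_cast
  clear hD h h1 h2 h3 h4 h5 h6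
  grind

theorem cn_mul_dn_sq (h : P.den ≠ 0) :
    (P.cn * P.dn) ^ 2 = (1 - P.sn ^ 2) * (1 - k ^ 2 * P.sn ^ 2) := by
  rw [mul_pow, P.dn_sq h, ← P.sn_sq_add_cn_sq h]
  ring

theorem cn_mul_dn : P.cn * P.dn =
    ((P.c * P.d * P.δ * (P.χ ^ 2 - k ^ 2 * P.s ^ 2 * P.σ ^ 2) : ℝ) - Complex.I *
      (P.s * P.σ * P.χ * (P.d ^ 2 * P.δ ^ 2 + k ^ 2 * P.c ^ 2) : ℝ)) / ((P.den ^ 2 : ℝ) : ℂ) := by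
  rw [cn, dn, div_mul_div_comm, ← sq, Complex.ofReal_pow]
  congr 1
  push_cast
  linear_combination (k : ℂ) ^ 2 * P.s ^ 2 * P.c * P.d * P.σ ^ 2 * P.δ * Complex.I_sq

theorem sn_re : P.sn.re = P.s * P.δ / P.den := by
  rw [sn, Complex.div_ofReal_re]; simp

theorem sn_im : P.sn.im = P.c * P.d * P.σ * P.χ / P.den := by
  rw [sn, Complex.div_ofReal_im]; simp

theorem cn_mul_dn_re : (P.cn * P.dn).re =
    P.c * P.d * P.δ * (P.χ ^ 2 - k ^ 2 * P.s ^ 2 * P.σ ^ 2) / P.den ^ 2 := by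
  rw [cn_mul_dn, Complex.div_ofReal_re]
  simp only [Complex.sub_re, Complex.ofReal_re, Complex.I_mul_re, Complex.ofReal_im, neg_zero,
    sub_zero]

theorem cn_mul_dn_im : (P.cn * P.dn).im =
    -(P.s * P.σ * P.χ * (P.d ^ 2 * P.δ ^ 2 + k ^ 2 * P.c ^ 2)) / P.den ^ 2 := by
  rw [cn_mul_dn, Complex.div_ofReal_im]
  simp only [Complex.sub_im, Complex.ofReal_re, Complex.I_mul_im, Complex.ofReal_im, zero_sub]

theorem normSq_one_add_sn (h : P.den ≠ 0) :
    Complex.normSq (1 + P.sn) = (1 + P.s * P.δ) ^ 2 / P.den := by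
  rw [Complex.normSq_apply, Complex.add_re, Complex.add_im, sn_re, sn_im, Complex.one_re,
    Complex.one_im, zero_add]
  field_simp
  obtain ⟨s, c, d, σ, χ, δ, h1, h2, h3, h4, h5, h6⟩ := P
  simp only [den]
  clear h h2 h5
  grind

theorem normSq_one_sub_sn (h : P.den ≠ 0) :
    Complex.normSq (1 - P.sn) = (1 - P.s * P.δ) ^ 2 / P.den := by
  rw [Complex.normSq_apply, Complex.sub_re, Complex.sub_im, sn_re, sn_im, Complex.one_re,
    Complex.one_im, zero_sub]
  field_simp
  obtain ⟨s, c, d, σ, χ, δ, h1, h2, h3, h4, h5, h6⟩ := P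
  simp only [den]
  clear h h2 h5
  grind

theorem normSq_one_add_mul_sn (h : P.den ≠ 0) :
    Complex.normSq (1 + k * P.sn) = (P.δ + k * P.s) ^ 2 / P.den := by
  rw [Complex.normSq_apply, Complex.add_re, Complex.add_im, Complex.re_ofReal_mul,
    Complex.im_ofReal_mul, sn_re, sn_im, Complex.one_re, Complex.one_im, zero_add]
  field_simp
  obtain ⟨s, c, d, σ, χ, δ, h1, h2, h3, h4, h5, h6⟩ := P
  simp only [den]
  clear h h2 h5
  grind

theorem normSq_one_sub_mul_sn (h : P.den ≠ 0) :
    Complex.normSq (1 - k * P.sn) = (P.δ - k * P.s) ^ 2 / P.den := by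
  rw [Complex.normSq_apply, Complex.sub_re, Complex.sub_im, Complex.re_ofReal_mul,
    Complex.im_ofReal_mul, sn_re, sn_im, Complex.one_re, Complex.one_im, zero_sub]
  field_simp
  obtain ⟨s, c, d, σ, χ, δ, h1, h2, h3, h4, h5, h6⟩ := P
  simp only [den]
  clear h h2 h5
  grind

/-- The data `P` and `Q` agree up to a common sign of `σ` and `χ`. Changing that sign is the
translation of `y` by half a period of `σ` and `χ`, a period of both `sn` and `cn dn`. -/
structure Equiv : Prop where
  s_eq : P.s = Q.s
  c_eq : P.c = Q.c
  δ_eq : P.δ = Q.δ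
  χ_sq_eq : P.χ ^ 2 = Q.χ ^ 2
  σ_mul_χ_eq : P.σ * P.χ = Q.σ * Q.χ

variable {P Q}

theorem Equiv.d_eq (h : Equiv P Q) : P.d = Q.d := by
  rw [← sq_eq_sq₀ P.d_pos.le Q.d_pos.le, P.d_sq, Q.d_sq, h.s_eq]

theorem Equiv.σ_sq_eq (h : Equiv P Q) : P.σ ^ 2 = Q.σ ^ 2 := by
  linarith [P.σ_sq_add_χ_sq, Q.σ_sq_add_χ_sq, h.χ_sq_eq]

theorem Equiv.den_eq (h : Equiv P Q) : P.den = Q.den := by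
  rw [den, den, h.χ_sq_eq, h.s_eq, h.σ_sq_eq]

theorem Equiv.sn_eq (h : Equiv P Q) : P.sn = Q.sn := by
  rw [sn, sn, h.den_eq, mul_assoc (P.c * P.d), mul_assoc (Q.c * Q.d), h.σ_mul_χ_eq, h.s_eq,
    h.δ_eq, h.c_eq, h.d_eq]

theorem Equiv.cn_mul_dn_eq (h : Equiv P Q) : P.cn * P.dn = Q.cn * Q.dn := by
  rw [cn_mul_dn, cn_mul_dn, h.den_eq, mul_assoc P.s, mul_assoc Q.s, h.σ_mul_χ_eq, h.s_eq,
    h.δ_eq, h.c_eq, h.d_eq, h.χ_sq_eq, h.σ_sq_eq]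

variable (P) in
theorem abs_s_mul_δ_le_one (hk : |k| ≤ 1) : |P.s * P.δ| ≤ 1 := by
  have hk2 := (sq_le_one_iff_abs_le_one k).2 hk
  have h1 : P.s ^ 2 ≤ 1 := by nlinarith [P.s_sq_add_c_sq, sq_nonneg P.c]
  have h2 : P.δ ^ 2 ≤ 1 := by nlinarith [P.δ_sq, mul_nonneg (sub_nonneg.2 hk2) (sq_nonneg P.σ)]
  rw [← sq_le_one_iff_abs_le_one, mul_pow]
  exact mul_le_one₀ h1 (sq_nonneg _) h2

variable (P) in
theorem abs_mul_s_le_δ (hk : |k| ≤ 1) : |k * P.s| ≤ P.δ := by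
  have hk2 := (sq_le_one_iff_abs_le_one k).2 hk
  have h1 : P.s ^ 2 ≤ 1 := by nlinarith [P.s_sq_add_c_sq, sq_nonneg P.c]
  have h2 : P.σ ^ 2 ≤ 1 := by nlinarith [P.σ_sq_add_χ_sq, sq_nonneg P.χ]
  refine abs_le_of_sq_le_sq ?_ P.δ_pos.le
  rw [mul_pow, P.δ_sq]
  nlinarith [mul_nonneg (sub_nonneg.2 hk2) (sub_nonneg.2 h2),
    mul_nonneg (sq_nonneg k) (sub_nonneg.2 h1)]

/-- The map from data to the values of `sn` and `cn dn` is injective up to periods. The moduli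
`|1 ± sn|` and `|1 ± k sn|` are `(1 ± s δ) / √den` and `(δ ± k s) / √den`, which determine
`den`, `s` and `δ`; the remaining signs are read off from `sn` and `cn dn`. -/
theorem equiv_of_sn_eq (hk : |k| ≤ 1) (hk0 : k ≠ 0) (hP : P.den ≠ 0) (hQ : Q.den ≠ 0)
    (hsn : P.sn = Q.sn) (hp : P.cn * P.dn = Q.cn * Q.dn) : Equiv P Q := by
  have key : ∀ a b : ℝ, 0 ≤ a → 0 ≤ b → a ^ 2 / P.den = b ^ 2 / Q.den →
      a / √P.den = b / √Q.den := by
    intro a b ha hb h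
    rw [← sq_eq_sq₀ (by positivity) (by positivity), div_pow, div_pow, Real.sq_sqrt P.den_nonneg,
      Real.sq_sqrt Q.den_nonneg, h]
  have hP1 := abs_le.1 (P.abs_s_mul_δ_le_one hk)
  have hQ1 := abs_le.1 (Q.abs_s_mul_δ_le_one hk)
  have hP2 := abs_le.1 (P.abs_mul_s_le_δ hk)
  have hQ2 := abs_le.1 (Q.abs_mul_s_le_δ hk)
  have e1 := key (1 + P.s * P.δ) (1 + Q.s * Q.δ) (by linarith) (by linarith)
    (by rw [← P.normSq_one_add_sn hP, hsn, Q.normSq_one_add_sn hQ])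
  have e2 := key (1 - P.s * P.δ) (1 - Q.s * Q.δ) (by linarith) (by linarith)
    (by rw [← P.normSq_one_sub_sn hP, hsn, Q.normSq_one_sub_sn hQ])
  have e3 := key (P.δ + k * P.s) (Q.δ + k * Q.s) (by linarith) (by linarith)
    (by rw [← P.normSq_one_add_mul_sn hP, hsn, Q.normSq_one_add_mul_sn hQ])
  have e4 := key (P.δ - k * P.s) (Q.δ - k * Q.s) (by linarith) (by linarith)
    (by rw [← P.normSq_one_sub_mul_sn hP, hsn, Q.normSq_one_sub_mul_sn hQ])
  have hPp : 0 < √P.den := Real.sqrt_pos.2 (lt_of_le_of_ne P.den_nonneg hP.symm)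
  have hr : √P.den = √Q.den := by
    have h : 2 / √P.den = 2 / √Q.den := by
      linear_combination e1 + e2
    have hQp : 0 < √Q.den := Real.sqrt_pos.2 (lt_of_le_of_ne Q.den_nonneg hQ.symm)
    field_simp at h
    exact h.symm
  have hden : P.den = Q.den := (Real.sqrt_inj P.den_nonneg Q.den_nonneg).1 hr
  rw [← hr, div_left_inj' hPp.ne'] at e3 e4
  have hδ : P.δ = Q.δ := by linarith
  have hs : P.s = Q.s := mul_left_cancel₀ hk0 (by linarith)
  have hd : P.d = Q.d := by rw [← sq_eq_sq₀ P.d_pos.le Q.d_pos.le, P.d_sq, Q.d_sq, hs]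
  have hχ : P.χ ^ 2 = Q.χ ^ 2 := by
    have h : P.d ^ 2 * P.χ ^ 2 = P.d ^ 2 * Q.χ ^ 2 := by
      have h1 := P.σ_sq_add_χ_sq
      have h2 := Q.σ_sq_add_χ_sq
      have h3 := hden
      rw [den, den, ← hs] at h3
      rw [P.d_sq]
      linear_combination h3 - k ^ 2 * P.s ^ 2 * h1 + k ^ 2 * P.s ^ 2 * h2
    exact mul_left_cancel₀ (pow_ne_zero 2 P.d_pos.ne') h
  have hσ : P.σ ^ 2 = Q.σ ^ 2 := by linarith [P.σ_sq_add_χ_sq, Q.σ_sq_add_χ_sq]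
  have hc : P.c ^ 2 = Q.c ^ 2 := by
    have h1 := P.s_sq_add_c_sq
    have h2 := Q.s_sq_add_c_sq
    rw [hs] at h1
    linarith
  have i1 : P.c * (P.σ * P.χ) = Q.c * (Q.σ * Q.χ) := by
    have h := congrArg Complex.im hsn
    rw [sn_im, sn_im, ← hden, div_left_inj' hP, ← hd] at h
    exact mul_left_cancel₀ P.d_pos.ne' (by linear_combination h)
  have hD2 : P.den ^ 2 ≠ 0 := pow_ne_zero 2 hP
  have i2 : P.c * (P.χ ^ 2 - k ^ 2 * P.s ^ 2 * P.σ ^ 2) =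
      Q.c * (P.χ ^ 2 - k ^ 2 * P.s ^ 2 * P.σ ^ 2) := by
    have h := congrArg Complex.re hp
    rw [cn_mul_dn_re, cn_mul_dn_re, ← hden, div_left_inj' hD2, ← hd, ← hδ, ← hs, ← hχ, ← hσ] at h
    exact mul_left_cancel₀ (mul_pos P.d_pos P.δ_pos).ne' (by linear_combination h)
  have i3 : P.s * (P.σ * P.χ) = P.s * (Q.σ * Q.χ) := by
    have h := congrArg Complex.im hp
    rw [cn_mul_dn_im, cn_mul_dn_im, ← hden, div_left_inj' hD2, ← hd, ← hδ, ← hs, ← hc] at h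
    have hpos : P.d ^ 2 * P.δ ^ 2 + k ^ 2 * P.c ^ 2 ≠ 0 := by
      have := P.d_pos
      have := P.δ_pos
      positivity
    exact mul_left_cancel₀ hpos (by linear_combination -h)
  -- `sn` and `cn dn` fix the signs of the products `c (σ χ)`, `s (σ χ)` and `c (χ² - k² s² σ²)`
  suffices h : P.c = Q.c ∧ P.σ * P.χ = Q.σ * Q.χ from ⟨hs, h.1, hδ, hχ, h.2⟩
  by_cases hs0 : P.s = 0
  · have hχ0 : P.χ ^ 2 - k ^ 2 * P.s ^ 2 * P.σ ^ 2 ≠ 0 := by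
      rw [den, hs0] at hP
      rw [hs0]
      simpa using hP
    have hc' := mul_right_cancel₀ hχ0 i2
    have hc0 : P.c ≠ 0 := by
      have h1 := P.s_sq_add_c_sq
      rw [hs0] at h1
      rintro h0
      rw [h0] at h1
      norm_num at h1
    refine ⟨hc', mul_left_cancel₀ hc0 ?_⟩
    rw [i1, hc']
  · have hY := mul_left_cancel₀ hs0 i3
    refine ⟨?_, hY⟩
    by_cases hY0 : P.σ * P.χ = 0
    -- one of `σ`, `χ` vanishes and the other is `±1`; if `χ = 0`, then `s ≠ 0` is needed
    · refine mul_right_cancel₀ ?_ i2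
      have h1 := P.σ_sq_add_χ_sq
      rcases mul_eq_zero.1 hY0 with h0 | h0
      · rw [h0] at h1 ⊢
        intro h2
        nlinarith
      · rw [h0] at h1 ⊢
        have : P.σ ^ 2 = 1 := by linarith
        rw [this]
        simp [hk0, hs0]
    · rw [← hY] at i1
      exact mul_right_cancel₀ hY0 i1

variable (P)

/-- Translation of `x + i y` by the half period `i K'` of `sn`. -/
noncomputable def shift (hk0 : k ≠ 0) : JacobiData k where
  s := P.s
  c := P.c
  d := P.d
  σ := P.χ / P.δ
  χ := -(|k| * P.σ / P.δ)
  δ := |k| / P.δ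
  s_sq_add_c_sq := P.s_sq_add_c_sq
  d_pos := P.d_pos
  d_sq := P.d_sq
  σ_sq_add_χ_sq := by
    have := P.δ_pos
    field_simp
    rw [sq_abs]
    linarith [P.δ_sq, P.σ_sq_add_χ_sq]
  δ_pos := div_pos (abs_pos.2 hk0) P.δ_pos
  δ_sq := by
    have := P.δ_pos
    field_simp
    rw [sq_abs]
    linear_combination -P.δ_sq + (1 - k ^ 2) * P.σ_sq_add_χ_sq

variable {P}

theorem shift_den (hk0 : k ≠ 0) :
    (P.shift hk0).den = k ^ 2 * (P.σ ^ 2 + P.s ^ 2 * P.χ ^ 2) / P.δ ^ 2 := by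
  have := P.δ_pos
  simp only [den, shift]
  field_simp
  rw [sq_abs]
  ring

theorem normSq_sn (h : P.den ≠ 0) :
    Complex.normSq P.sn = (P.σ ^ 2 + P.s ^ 2 * P.χ ^ 2) / P.den := by
  rw [Complex.normSq_apply, sn_re, sn_im]
  field_simp
  obtain ⟨s, c, d, σ, χ, δ, h1, h2, h3, h4, h5, h6⟩ := P
  simp only [den]
  clear h h2 h5
  grind

theorem shift_den_ne_zero (hk0 : k ≠ 0) (h : P.sn ≠ 0) : (P.shift hk0).den ≠ 0 := by
  have hn := Complex.normSq_pos.2 h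
  rw [normSq_sn (P.den_ne_zero_of_sn_ne_zero h)] at hn
  rw [shift_den]
  have h1 : P.σ ^ 2 + P.s ^ 2 * P.χ ^ 2 ≠ 0 := by
    intro h0
    rw [h0, zero_div] at hn
    exact hn.false
  have := P.δ_pos
  positivity

theorem shift_sn (hk0 : k ≠ 0) (h : P.sn ≠ 0) : (P.shift hk0).sn * (|k| * P.sn) = 1 := by
  have hD := P.den_ne_zero_of_sn_ne_zero h
  have hE := shift_den_ne_zero hk0 h
  have hD' : (P.den : ℂ) ≠ 0 := Complex.ofReal_ne_zero.2 hD
  have hE' : ((P.shift hk0).den : ℂ) ≠ 0 := Complex.ofReal_ne_zero.2 hE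
  have hδ' : (P.δ : ℂ) ≠ 0 := Complex.ofReal_ne_zero.2 P.δ_pos.ne'
  rw [sn, sn, ← mul_div_assoc, div_mul_div_comm, div_eq_one_iff_eq (mul_ne_zero hE' hD')]
  rw [shift_den]
  simp only [shift]
  have gk : ((|k| : ℝ) : ℂ) ^ 2 = k ^ 2 := by exact_mod_cast sq_abs k
  have hI := Complex.I_sq
  obtain ⟨s, c, d, σ, χ, δ, h1, h2, h3, h4, h5, h6⟩ := P
  have g1 : (s : ℂ) ^ 2 + c ^ 2 = 1 := by exact_mod_cast h1
  have g3 : (d : ℂ) ^ 2 = 1 - k ^ 2 * s ^ 2 := by exact_mod_cast h3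
  have g4 : (σ : ℂ) ^ 2 + χ ^ 2 = 1 := by exact_mod_cast h4
  have g6 : (δ : ℂ) ^ 2 = 1 - (1 - k ^ 2) * σ ^ 2 := by exact_mod_cast h6
  simp only [den] at *
  push_cast
  field_simp
  clear hD hE hD' hE' hδ' h h1 h2 h3 h4 h5 h6 hk0
  grind

theorem shift_cn (hk0 : k ≠ 0) (h : P.sn ≠ 0) :
    (P.shift hk0).cn * (|k| * P.sn) = -(Complex.I * P.dn) := by
  have hD := P.den_ne_zero_of_sn_ne_zero h
  have hE := shift_den_ne_zero hk0 h
  have hD' : (P.den : ℂ) ≠ 0 := Complex.ofReal_ne_zero.2 hD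
  have hE' : ((P.shift hk0).den : ℂ) ≠ 0 := Complex.ofReal_ne_zero.2 hE
  have hδ' : (P.δ : ℂ) ≠ 0 := Complex.ofReal_ne_zero.2 P.δ_pos.ne'
  rw [cn, sn, dn, ← mul_div_assoc, div_mul_div_comm, ← mul_div_assoc, ← neg_div,
    div_eq_div_iff (mul_ne_zero hE' hD') hD', ← mul_assoc _ _ (P.den : ℂ), mul_left_inj' hD']
  rw [shift_den]
  simp only [shift]
  have gk : ((|k| : ℝ) : ℂ) ^ 2 = k ^ 2 := by exact_mod_cast sq_abs k
  have hI := Complex.I_sq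
  obtain ⟨s, c, d, σ, χ, δ, h1, h2, h3, h4, h5, h6⟩ := P
  have g1 : (s : ℂ) ^ 2 + c ^ 2 = 1 := by exact_mod_cast h1
  have g3 : (d : ℂ) ^ 2 = 1 - k ^ 2 * s ^ 2 := by exact_mod_cast h3
  have g4 : (σ : ℂ) ^ 2 + χ ^ 2 = 1 := by exact_mod_cast h4
  have g6 : (δ : ℂ) ^ 2 = 1 - (1 - k ^ 2) * σ ^ 2 := by exact_mod_cast h6
  simp only [den] at *
  push_cast
  field_simp
  clear hD hE hD' hE' hδ' h h1 h2 h3 h4 h5 h6 hk0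
  grind

theorem shift_dn (hk0 : k ≠ 0) (h : P.sn ≠ 0) : (P.shift hk0).dn * P.sn = -(Complex.I * P.cn) := by
  have hD := P.den_ne_zero_of_sn_ne_zero h
  have hE := shift_den_ne_zero hk0 h
  have hD' : (P.den : ℂ) ≠ 0 := Complex.ofReal_ne_zero.2 hD
  have hE' : ((P.shift hk0).den : ℂ) ≠ 0 := Complex.ofReal_ne_zero.2 hE
  have hδ' : (P.δ : ℂ) ≠ 0 := Complex.ofReal_ne_zero.2 P.δ_pos.ne'
  rw [dn, sn, cn, div_mul_div_comm, ← mul_div_assoc, ← neg_div,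
    div_eq_div_iff (mul_ne_zero hE' hD') hD', ← mul_assoc _ _ (P.den : ℂ), mul_left_inj' hD']
  rw [shift_den]
  simp only [shift]
  have gk : ((|k| : ℝ) : ℂ) ^ 2 = k ^ 2 := by exact_mod_cast sq_abs k
  have hI := Complex.I_sq
  obtain ⟨s, c, d, σ, χ, δ, h1, h2, h3, h4, h5, h6⟩ := P
  have g1 : (s : ℂ) ^ 2 + c ^ 2 = 1 := by exact_mod_cast h1
  have g3 : (d : ℂ) ^ 2 = 1 - k ^ 2 * s ^ 2 := by exact_mod_cast h3
  have g4 : (σ : ℂ) ^ 2 + χ ^ 2 = 1 := by exact_mod_cast h4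
  have g6 : (δ : ℂ) ^ 2 = 1 - (1 - k ^ 2) * σ ^ 2 := by exact_mod_cast h6
  simp only [den] at *
  push_cast
  field_simp
  clear hD hE hD' hE' hδ' h h1 h2 h3 h4 h5 h6 hk0
  grind

theorem shift_cn_mul_dn (hk0 : k ≠ 0) (h : P.sn ≠ 0) :
    P.cn * P.dn + |k| * P.sn ^ 2 * ((P.shift hk0).cn * (P.shift hk0).dn) = 0 := by
  linear_combination (P.shift hk0).dn * P.sn * shift_cn hk0 h - Complex.I * P.dn * shift_dn hk0 h +
    P.cn * P.dn * Complex.I_sq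

end JacobiData

namespace JacobiData

variable {k : ℝ}

/-- The data of the point `2K - x + i y`. -/
def reflect (P : JacobiData k) : JacobiData k where
  s := P.s
  c := -P.c
  d := P.d
  σ := P.σ
  χ := P.χ
  δ := P.δ
  s_sq_add_c_sq := by rw [neg_sq]; exact P.s_sq_add_c_sq
  d_pos := P.d_pos
  d_sq := P.d_sq
  σ_sq_add_χ_sq := P.σ_sq_add_χ_sq
  δ_pos := P.δ_pos
  δ_sq := P.δ_sq

/-- The data of the conjugate point `x - i y`. -/
def conj (P : JacobiData k) : JacobiData k where
  s := P.s
  c := P.c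
  d := P.d
  σ := -P.σ
  χ := P.χ
  δ := P.δ
  s_sq_add_c_sq := P.s_sq_add_c_sq
  d_pos := P.d_pos
  d_sq := P.d_sq
  σ_sq_add_χ_sq := by rw [neg_sq]; exact P.σ_sq_add_χ_sq
  δ_pos := P.δ_pos
  δ_sq := by rw [neg_sq]; exact P.δ_sq

theorem den_conj (P : JacobiData k) : P.conj.den = P.den := by
  simp only [den, conj, neg_sq]

theorem sn_conj (P : JacobiData k) : P.conj.sn = (starRingEnd ℂ) P.sn := by
  apply Complex.ext
  · rw [Complex.conj_re, sn_re, sn_re, den_conj]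
    rfl
  · rw [Complex.conj_im, sn_im, sn_im, den_conj]
    simp only [conj]
    ring

theorem den_reflect_conj (P : JacobiData k) : P.conj.reflect.den = P.den := P.den_conj

theorem sn_reflect_conj (P : JacobiData k) : P.conj.reflect.sn = P.sn := by
  simp only [sn, den_reflect_conj]
  simp only [conj, reflect]
  push_cast
  ring

theorem cn_mul_dn_reflect_conj (P : JacobiData k) :
    P.conj.reflect.cn * P.conj.reflect.dn = -(P.cn * P.dn) := by
  rw [cn_mul_dn, cn_mul_dn, den_reflect_conj]
  simp only [conj, reflect]
  push_cast
  ring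

/-- Up to conjugation every complex number is a value of `sn`: solve
`|1 ± w| = (1 ± s δ) / √den` and `|1 ± k w| = (δ ± k s) / √den` for `s`, `δ` and `den`. -/
theorem exists_re_normSq_eq (hk : |k| < 1) (hk0 : k ≠ 0) (w : ℂ) :
    ∃ P : JacobiData k, P.den ≠ 0 ∧ P.sn.re = w.re ∧ Complex.normSq P.sn = Complex.normSq w := by
  have hk2 : k ^ 2 < 1 := (sq_lt_one_iff_abs_lt_one k).2 hk
  obtain ⟨hkl, hkr⟩ := abs_lt.1 hk
  set A := ‖1 + w‖ with hA
  set B := ‖1 - w‖ with hB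
  set A' := ‖1 + k * w‖ with hA'
  set B' := ‖1 - k * w‖ with hB'
  have hA2 : A ^ 2 = 1 + 2 * w.re + Complex.normSq w := by
    rw [hA, ← Complex.normSq_eq_norm_sq, Complex.normSq_apply, Complex.normSq_apply]
    simp only [Complex.add_re, Complex.add_im, Complex.one_re, Complex.one_im]
    ring
  have hB2 : B ^ 2 = 1 - 2 * w.re + Complex.normSq w := by
    rw [hB, ← Complex.normSq_eq_norm_sq, Complex.normSq_apply, Complex.normSq_apply]
    simp only [Complex.sub_re, Complex.sub_im, Complex.one_re, Complex.one_im]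
    ring
  have hA2' : A' ^ 2 = 1 + 2 * k * w.re + k ^ 2 * Complex.normSq w := by
    rw [hA', ← Complex.normSq_eq_norm_sq, Complex.normSq_apply, Complex.normSq_apply]
    simp only [Complex.add_re, Complex.add_im, Complex.one_re, Complex.one_im,
      Complex.re_ofReal_mul, Complex.im_ofReal_mul]
    ring
  have hB2' : B' ^ 2 = 1 - 2 * k * w.re + k ^ 2 * Complex.normSq w := by
    rw [hB', ← Complex.normSq_eq_norm_sq, Complex.normSq_apply, Complex.normSq_apply]
    simp only [Complex.sub_re, Complex.sub_im, Complex.one_re, Complex.one_im,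
      Complex.re_ofReal_mul, Complex.im_ofReal_mul]
    ring
  have hA0 : 0 ≤ A := norm_nonneg _
  have hB0 : 0 ≤ B := norm_nonneg _
  have hA0' : 0 ≤ A' := norm_nonneg _
  have hB0' : 0 ≤ B' := norm_nonneg _
  have hAB : 2 ≤ A + B := by
    have h := norm_add_le (1 + w) (1 - w)
    rw [show 1 + w + (1 - w) = (2 : ℂ) by ring, Complex.norm_ofNat] at h
    exact h
  -- each of `1 ± k w` is a convex combination of `1 + w` and `1 - w`
  have hup : A' + B' ≤ A + B := by
    have h1 : A' ≤ (1 + k) / 2 * A + (1 - k) / 2 * B := by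
      have h := norm_add_le (((1 + k) / 2 : ℝ) * (1 + w)) (((1 - k) / 2 : ℝ) * (1 - w))
      rw [norm_mul, norm_mul, Complex.norm_real, Complex.norm_real,
        Real.norm_of_nonneg (by linarith), Real.norm_of_nonneg (by linarith)] at h
      refine le_trans (le_of_eq ?_) h
      rw [hA']; congr 1; push_cast; ring
    have h2 : B' ≤ (1 - k) / 2 * A + (1 + k) / 2 * B := by
      have h := norm_add_le (((1 - k) / 2 : ℝ) * (1 + w)) (((1 + k) / 2 : ℝ) * (1 - w))
      rw [norm_mul, norm_mul, Complex.norm_real, Complex.norm_real,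
        Real.norm_of_nonneg (by linarith), Real.norm_of_nonneg (by linarith)] at h
      refine le_trans (le_of_eq ?_) h
      rw [hB']; congr 1; push_cast; ring
    linarith
  -- with `m = |1 + w| + |1 - w|`, the equations read `s δ = (|1+w| - |1-w|) / m` and so on
  set m := A + B with hm
  have hm0 : 0 < m := by linarith
  set s := (A' - B') / (k * m) with hs
  set δ := (A' + B') / m with hδ
  have hks : k * s * m = A' - B' := by rw [hs]; field_simp
  have hδm : δ * m = A' + B' := by rw [hδ]; field_simp
  have hsδ : s * δ * m = A - B := by
    have h : (s * δ * m) * (k * m) = (A - B) * (k * m) := by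
      calc (s * δ * m) * (k * m) = (k * s * m) * (δ * m) := by ring
        _ = (A - B) * (k * m) := by
          rw [hks, hδm, hm]; linear_combination hA2' - hB2' - k * hA2 + k * hB2
    exact mul_right_cancel₀ (mul_ne_zero hk0 hm0.ne') h
  have hδ1 : δ ≤ 1 := by rw [hδ, div_le_one hm0]; exact hup
  have hδ0 : 0 ≤ δ := by positivity
  have hN : m ^ 2 * (1 + s ^ 2 * δ ^ 2) = 4 + 4 * Complex.normSq w := by
    have : m ^ 2 * (1 + s ^ 2 * δ ^ 2) = m ^ 2 + (s * δ * m) ^ 2 := by ring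
    rw [this, hsδ, hm]
    linear_combination 2 * hA2 + 2 * hB2
  have hN' : m ^ 2 * (δ ^ 2 + k ^ 2 * s ^ 2) = 4 + 4 * k ^ 2 * Complex.normSq w := by
    have : m ^ 2 * (δ ^ 2 + k ^ 2 * s ^ 2) = (δ * m) ^ 2 + (k * s * m) ^ 2 := by ring
    rw [this, hδm, hks]
    linear_combination 2 * hA2' + 2 * hB2'
  -- eliminating `|w|²`; the left side is `m² (1 - k²) den`
  have hprod : m ^ 2 * ((δ ^ 2 - k ^ 2) + k ^ 2 * s ^ 2 * (1 - δ ^ 2)) = 4 * (1 - k ^ 2) := by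
    linear_combination hN' - k ^ 2 * hN
  have hs2 : s ^ 2 ≤ 1 := by
    have h : |A' - B'| ≤ |k| * m := by
      have h1 := abs_norm_sub_norm_le (1 + (k : ℂ) * w) (1 - k * w)
      refine h1.trans ?_
      rw [show 1 + (k : ℂ) * w - (1 - k * w) = k * ((1 + w) - (1 - w)) by ring, norm_mul,
        Complex.norm_real, Real.norm_eq_abs]
      exact mul_le_mul_of_nonneg_left (norm_sub_le _ _) (abs_nonneg _)
    rw [hs, div_pow, div_le_one (by positivity), sq_le_sq, abs_mul, abs_of_pos hm0]
    exact h
  have hδk : k ^ 2 ≤ δ ^ 2 := by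
    -- conversely, `k (1 ± w)` is a combination of `1 + k w` and `1 - k w`
    have h : |k| * m ≤ A' + B' := by
      have h1 : |k| * A ≤ (1 + k) / 2 * A' + (1 - k) / 2 * B' := by
        have h := norm_sub_le (((1 + k) / 2 : ℝ) * (1 + k * w)) (((1 - k) / 2 : ℝ) * (1 - k * w))
        rw [norm_mul, norm_mul, Complex.norm_real, Complex.norm_real,
          Real.norm_of_nonneg (by linarith), Real.norm_of_nonneg (by linarith)] at h
        refine le_trans (le_of_eq ?_) h
        rw [hA, ← Real.norm_eq_abs, ← Complex.norm_real, ← norm_mul]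
        congr 1; push_cast; ring
      have h2 : |k| * B ≤ (1 - k) / 2 * A' + (1 + k) / 2 * B' := by
        have h := norm_sub_le (((1 - k) / 2 : ℝ) * (1 + k * w)) (((1 + k) / 2 : ℝ) * (1 - k * w))
        rw [norm_mul, norm_mul, Complex.norm_real, Complex.norm_real,
          Real.norm_of_nonneg (by linarith), Real.norm_of_nonneg (by linarith)] at h
        refine le_trans (le_of_eq ?_) h
        rw [hB, ← Real.norm_eq_abs, ← Complex.norm_real, ← norm_mul, ← norm_neg]
        congr 1; push_cast; ring
      rw [hm]; linarith
    rw [hδ, div_pow, le_div_iff₀ (by positivity), ← mul_pow, sq_le_sq, abs_mul, abs_of_pos hm0,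
      abs_of_nonneg (add_nonneg hA0' hB0')]
    exact h
  have hq : 0 < 1 - k ^ 2 := by linarith
  have hσ2 : √((1 - δ ^ 2) / (1 - k ^ 2)) ^ 2 = (1 - δ ^ 2) / (1 - k ^ 2) :=
    Real.sq_sqrt (div_nonneg (by nlinarith) hq.le)
  have hχ2 : √((δ ^ 2 - k ^ 2) / (1 - k ^ 2)) ^ 2 = (δ ^ 2 - k ^ 2) / (1 - k ^ 2) :=
    Real.sq_sqrt (div_nonneg (by linarith) hq.le)
  have hks2 : 0 < 1 - k ^ 2 * s ^ 2 := by nlinarith [sq_nonneg k]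
  have hkpos : 0 < k ^ 2 := by positivity
  let P : JacobiData k :=
    { s := s
      c := √(1 - s ^ 2)
      d := √(1 - k ^ 2 * s ^ 2)
      σ := √((1 - δ ^ 2) / (1 - k ^ 2))
      χ := √((δ ^ 2 - k ^ 2) / (1 - k ^ 2))
      δ := δ
      s_sq_add_c_sq := by rw [Real.sq_sqrt (by linarith)]; ring
      d_pos := Real.sqrt_pos.2 hks2
      d_sq := Real.sq_sqrt hks2.le
      σ_sq_add_χ_sq := by rw [hσ2, hχ2]; field_simp; ring
      δ_pos := by
        refine lt_of_le_of_ne hδ0 fun h => ?_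
        rw [← h] at hδk
        linarith
      δ_sq := by rw [hσ2]; field_simp; ring }
  have hden : P.den = 4 / m ^ 2 := by
    change √((δ ^ 2 - k ^ 2) / (1 - k ^ 2)) ^ 2 +
      k ^ 2 * s ^ 2 * √((1 - δ ^ 2) / (1 - k ^ 2)) ^ 2 = _
    rw [hσ2, hχ2]
    field_simp
    linear_combination hprod
  have hden0 : P.den ≠ 0 := by rw [hden]; positivity
  have h1 : Complex.normSq (1 + P.sn) = A ^ 2 := by
    rw [P.normSq_one_add_sn hden0, hden]
    change (1 + s * δ) ^ 2 / (4 / m ^ 2) = _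
    have : A = (1 + s * δ) * m / 2 := by linear_combination -hsδ / 2 + (-1 / 2) * hm
    rw [this]; field_simp; ring
  have h2 : Complex.normSq (1 - P.sn) = B ^ 2 := by
    rw [P.normSq_one_sub_sn hden0, hden]
    change (1 - s * δ) ^ 2 / (4 / m ^ 2) = _
    have : B = (1 - s * δ) * m / 2 := by linear_combination hsδ / 2 + (-1 / 2) * hm
    rw [this]; field_simp; ring
  rw [hA2, Complex.normSq_apply] at h1
  rw [hB2, Complex.normSq_apply] at h2
  simp only [Complex.add_re, Complex.add_im, Complex.one_re, Complex.one_im, Complex.sub_re,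
    Complex.sub_im] at h1 h2
  refine ⟨P, hden0, by linarith, ?_⟩
  rw [Complex.normSq_apply]
  linarith

/-- Conjugation and the reflection in `K`, which changes the sign of `cn dn`, adjust the remaining
signs: every point `(w, p)` of the elliptic curve `p² = (1 - w²)(1 - k² w²)` is of the form
`(sn, cn dn)`. -/
theorem exists_sn_eq (hk : |k| < 1) (hk0 : k ≠ 0) {w p : ℂ}
    (h : p ^ 2 = (1 - w ^ 2) * (1 - k ^ 2 * w ^ 2)) :
    ∃ P : JacobiData k, P.den ≠ 0 ∧ P.sn = w ∧ P.cn * P.dn = p := by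
  obtain ⟨P, hD, hre, hn⟩ := exists_re_normSq_eq hk hk0 w
  obtain ⟨Q, hQ, hw⟩ : ∃ Q : JacobiData k, Q.den ≠ 0 ∧ Q.sn = w := by
    rw [Complex.normSq_apply, Complex.normSq_apply, hre] at hn
    have him : P.sn.im ^ 2 = w.im ^ 2 := by linear_combination hn
    rcases sq_eq_sq_iff_eq_or_eq_neg.1 him with h1 | h1
    · exact ⟨P, hD, Complex.ext hre h1⟩
    · refine ⟨P.conj, by rwa [den_conj], ?_⟩
      rw [sn_conj]
      refine Complex.ext hre ?_
      rw [Complex.conj_im, h1, neg_neg]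
  have hp : (Q.cn * Q.dn) ^ 2 = p ^ 2 := by rw [Q.cn_mul_dn_sq hQ, hw, h]
  rcases sq_eq_sq_iff_eq_or_eq_neg.1 hp with h1 | h1
  · exact ⟨Q, hQ, hw, h1⟩
  · refine ⟨Q.conj.reflect, by rwa [den_reflect_conj], by rw [sn_reflect_conj, hw], ?_⟩
    rw [cn_mul_dn_reflect_conj, h1, neg_neg]

end JacobiData

/-! ### The Jacobi functions of a complex argument -/

/-- The data of a complex number `z = x + i y`. -/
noncomputable def jacobiData {k : ℝ} (hk : |k| ≤ 1) (z : ℂ) : JacobiData k where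
  s := realSn k z.re
  c := realCn k z.re
  d := realDn k z.re
  σ := realSn (coModulus k) z.im
  χ := realCn (coModulus k) z.im
  δ := realDn (coModulus k) z.im
  s_sq_add_c_sq := realSn_sq_add_realCn_sq _ _
  d_pos := realDn_pos hk _
  d_sq := realDn_sq hk _
  σ_sq_add_χ_sq := realSn_sq_add_realCn_sq _ _
  δ_pos := realDn_pos (abs_coModulus_le_one k) _
  δ_sq := by rw [realDn_sq (abs_coModulus_le_one k), coModulus_sq hk]

section Aux

variable {k : ℝ} (hk : |k| ≤ 1)
include hk

theorem snAux_eq (z : ℂ) : snAux k z = (jacobiData hk z).sn := rfl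

theorem cnAux_eq (z : ℂ) : cnAux k z = (jacobiData hk z).cn := rfl

theorem dnAux_eq (z : ℂ) : dnAux k z = (jacobiData hk z).dn := rfl

/-- Where `sn` is nonzero, the three functions have the classical derivatives along horizontal
lines. There `x` moves and `y` is fixed, so that only the real derivatives with modulus `k`
enter. -/
theorem hasDerivAt_aux (b : ℝ) (z : ℂ) (t : ℝ) (h : snAux k (b * t + z) ≠ 0) :
    HasDerivAt (fun t : ℝ => snAux k (b * t + z))
      (b * (cnAux k (b * t + z) * dnAux k (b * t + z))) t ∧
    HasDerivAt (fun t : ℝ => cnAux k (b * t + z))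
      (-(b * (snAux k (b * t + z) * dnAux k (b * t + z)))) t ∧
    HasDerivAt (fun t : ℝ => dnAux k (b * t + z))
      (-(b * (k ^ 2 * snAux k (b * t + z) * cnAux k (b * t + z)))) t := by
  have hre : ∀ t : ℝ, ((b : ℂ) * t + z).re = b * t + z.re := fun t => by simp
  have him : ∀ t : ℝ, ((b : ℂ) * t + z).im = z.im := fun t => by simp
  have hD : jacobiDen k (b * t + z) ≠ 0 := (jacobiData hk _).den_ne_zero_of_sn_ne_zero h
  have hlin : HasDerivAt (fun t : ℝ => b * t + z.re) b t := by
    simpa using ((hasDerivAt_id t).const_mul b).add_const z.re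
  have hs : HasDerivAt (fun t : ℝ => realSn k (b * t + z.re))
      (realCn k (b * t + z.re) * realDn k (b * t + z.re) * b) t :=
    HasDerivAt.comp (h₂ := realSn k) t (hasDerivAt_realSn hk (b * t + z.re)) hlin
  have hc : HasDerivAt (fun t : ℝ => realCn k (b * t + z.re))
      (-(realSn k (b * t + z.re) * realDn k (b * t + z.re)) * b) t :=
    HasDerivAt.comp (h₂ := realCn k) t (hasDerivAt_realCn hk (b * t + z.re)) hlin
  have hd : HasDerivAt (fun t : ℝ => realDn k (b * t + z.re))
      (-(k ^ 2 * realSn k (b * t + z.re) * realCn k (b * t + z.re)) * b) t :=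
    HasDerivAt.comp (h₂ := realDn k) t (hasDerivAt_realDn hk (b * t + z.re)) hlin
  have h1 := realSn_sq_add_realCn_sq k (b * t + z.re)
  have h2 := realDn_sq hk (b * t + z.re)
  have h3 := realSn_sq_add_realCn_sq (coModulus k) z.im
  have h4 := realDn_sq (abs_coModulus_le_one k) z.im
  rw [coModulus_sq hk] at h4
  clear h
  simp only [snAux, cnAux, dnAux, jacobiDen, hre, him] at hD ⊢
  generalize hσ : realSn (coModulus k) z.im = σ at *
  generalize hχ : realCn (coModulus k) z.im = χ at *
  generalize hδ : realDn (coModulus k) z.im = δ at *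
  have hden := (((hs.pow 2).const_mul (k ^ 2)).mul_const (σ ^ 2)).const_add (χ ^ 2)
  have hsn := ((hs.mul_const δ).ofReal_comp.add
    ((((hc.mul hd).mul_const σ).mul_const χ).ofReal_comp.const_mul Complex.I)).div hden.ofReal_comp
    (Complex.ofReal_ne_zero.2 hD)
  have hcn := ((hc.mul_const χ).ofReal_comp.sub
    ((((hs.mul hd).mul_const σ).mul_const δ).ofReal_comp.const_mul Complex.I)).div hden.ofReal_comp
    (Complex.ofReal_ne_zero.2 hD)
  have hdn := (((hd.mul_const χ).mul_const δ).ofReal_comp.sub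
    ((((hs.const_mul (k ^ 2)).mul hc).mul_const σ).ofReal_comp.const_mul Complex.I)).div
    hden.ofReal_comp (Complex.ofReal_ne_zero.2 hD)
  have hI := Complex.I_sq
  refine ⟨HasDerivAt.congr_deriv hsn ?_, HasDerivAt.congr_deriv hcn ?_,
    HasDerivAt.congr_deriv hdn ?_⟩
  all_goals
    clear hsn hcn hdn hden hs hc hd hlin hre him
    have hD' := Complex.ofReal_ne_zero.2 hD
    simp only [Pi.pow_apply, Pi.mul_apply, Pi.add_apply, Pi.sub_apply] at hD' ⊢
    generalize realSn k (b * t + z.re) = s at *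
    generalize realCn k (b * t + z.re) = c at *
    generalize realDn k (b * t + z.re) = d at *
    have g1 : (s : ℂ) ^ 2 + c ^ 2 = 1 := by exact_mod_cast h1
    have g2 : (d : ℂ) ^ 2 = 1 - k ^ 2 * s ^ 2 := by exact_mod_cast h2
    have g3 : (σ : ℂ) ^ 2 + χ ^ 2 = 1 := by exact_mod_cast h3
    have g4 : (δ : ℂ) ^ 2 = 1 - (1 - k ^ 2) * σ ^ 2 := by exact_mod_cast h4
    push_cast at hD' ⊢
    generalize hDe : (χ : ℂ) ^ 2 + k ^ 2 * s ^ 2 * σ ^ 2 = D at *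
    field_simp
    clear hD hD' h1 h2 h3 h4 hσ hχ hδ hk
    grind

theorem hasDerivAt_snAux (b : ℝ) (z : ℂ) (t : ℝ) (h : snAux k (b * t + z) ≠ 0) :
    HasDerivAt (fun t : ℝ => snAux k (b * t + z))
      (b * (cnAux k (b * t + z) * dnAux k (b * t + z))) t :=
  (hasDerivAt_aux hk b z t h).1

theorem cnAux_mul_dnAux_sq {z : ℂ} (h : snAux k z ≠ 0) :
    (cnAux k z * dnAux k z) ^ 2 = (1 - snAux k z ^ 2) * (1 - k ^ 2 * snAux k z ^ 2) :=
  (jacobiData hk z).cn_mul_dn_sq ((jacobiData hk z).den_ne_zero_of_sn_ne_zero h)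

theorem hasDerivAt_cnAux_mul_dnAux (b : ℝ) (z : ℂ) (t : ℝ) (h : snAux k (b * t + z) ≠ 0) :
    HasDerivAt (fun t : ℝ => cnAux k (b * t + z) * dnAux k (b * t + z))
      (b * (-(1 + k ^ 2) * snAux k (b * t + z) + 2 * k ^ 2 * snAux k (b * t + z) ^ 3)) t := by
  obtain ⟨-, hc, hd⟩ := hasDerivAt_aux hk b z t h
  refine (hc.mul hd).congr_deriv ?_
  have hD := (jacobiData hk _).den_ne_zero_of_sn_ne_zero h
  have h1 := (jacobiData hk (b * t + z)).sn_sq_add_cn_sq hD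
  have h2 := (jacobiData hk (b * t + z)).dn_sq hD
  rw [← snAux_eq, ← cnAux_eq] at h1
  rw [← snAux_eq, ← dnAux_eq] at h2
  linear_combination (-b * snAux k (b * t + z)) * h2 - b * k ^ 2 * snAux k (b * t + z) * h1

/-- If `sn z₀ sn z₁ = 1 / |k|`, and if the derivatives at `z₀` and `z₁` are related accordingly,
then `z₁ = z₀ + i K'` up to periods, so that the relations persist at all real translates. -/
theorem snAux_add_of_snAux_mul_eq (hk0 : k ≠ 0) {z₀ z₁ : ℂ}
    (h : |k| * (snAux k z₀ * snAux k z₁) = 1)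
    (hp : cnAux k z₀ * dnAux k z₀ + |k| * snAux k z₀ ^ 2 * (cnAux k z₁ * dnAux k z₁) = 0)
    (t : ℝ) (ht : snAux k (t + z₀) ≠ 0) :
    |k| * (snAux k (t + z₀) * snAux k (t + z₁)) = 1 ∧
    cnAux k (t + z₀) * dnAux k (t + z₀) +
      |k| * snAux k (t + z₀) ^ 2 * (cnAux k (t + z₁) * dnAux k (t + z₁)) = 0 := by
  have hk' : ((|k| : ℝ) : ℂ) ≠ 0 := by simpa using hk0
  have h0 : snAux k z₀ ≠ 0 := by
    intro h0
    simp [h0] at h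
  have h1 : snAux k z₁ ≠ 0 := by
    intro h1
    simp [h1] at h
  have hE : JacobiData.Equiv (jacobiData hk z₁) ((jacobiData hk z₀).shift hk0) := by
    refine JacobiData.equiv_of_sn_eq hk hk0 ((jacobiData hk z₁).den_ne_zero_of_sn_ne_zero h1)
      (JacobiData.shift_den_ne_zero hk0 h0) ?_ ?_
    · refine mul_right_cancel₀ (mul_ne_zero hk' h0) ?_
      have := JacobiData.shift_sn (P := jacobiData hk z₀) hk0 h0
      rw [← snAux_eq] at this ⊢
      rw [this, ← h]
      ring
    · refine mul_left_cancel₀ (mul_ne_zero hk' (pow_ne_zero 2 h0)) ?_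
      have := JacobiData.shift_cn_mul_dn (P := jacobiData hk z₀) hk0 h0
      rw [← snAux_eq, ← cnAux_eq, ← dnAux_eq] at this
      rw [← cnAux_eq, ← dnAux_eq]
      linear_combination hp - this
  have hre : ∀ z : ℂ, ((t : ℂ) + z).re = t + z.re := fun z => by simp
  have him : ∀ z : ℂ, ((t : ℂ) + z).im = z.im := fun z => by simp
  obtain ⟨e1, e2⟩ := realSn_realCn_add_eq hk hE.s_eq hE.c_eq t
  have hE' : JacobiData.Equiv (jacobiData hk (t + z₁)) ((jacobiData hk (t + z₀)).shift hk0) := by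
    constructor
    · simpa only [jacobiData, JacobiData.shift, hre] using e1
    · simpa only [jacobiData, JacobiData.shift, hre] using e2
    · simpa only [jacobiData, JacobiData.shift, him] using hE.δ_eq
    · simpa only [jacobiData, JacobiData.shift, him] using hE.χ_sq_eq
    · simpa only [jacobiData, JacobiData.shift, him] using hE.σ_mul_χ_eq
  have f1 := JacobiData.shift_sn (P := jacobiData hk (t + z₀)) hk0 ht
  have f2 := JacobiData.shift_cn_mul_dn (P := jacobiData hk (t + z₀)) hk0 ht
  rw [← hE'.sn_eq] at f1
  rw [← hE'.cn_mul_dn_eq] at f2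
  simp only [← snAux_eq, ← cnAux_eq, ← dnAux_eq] at f1 f2
  exact ⟨by rw [← f1]; ring, f2⟩

end Aux

theorem exists_snAux_eq_of_lt {k : ℝ} (hk : |k| < 1) (hk0 : k ≠ 0) {w p : ℂ}
    (h : p ^ 2 = (1 - w ^ 2) * (1 - k ^ 2 * w ^ 2)) :
    ∃ z, snAux k z = w ∧ cnAux k z * dnAux k z = p := by
  obtain ⟨P, -, hw, hp⟩ := JacobiData.exists_sn_eq hk hk0 h
  obtain ⟨x, hx1, hx2⟩ := exists_realSn_realCn_eq hk P.s_sq_add_c_sq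
  obtain ⟨y, hy1, hy2⟩ := exists_realSn_realCn_eq (abs_coModulus_lt_one hk0) P.σ_sq_add_χ_sq
  have hE : JacobiData.Equiv (jacobiData hk.le ⟨x, y⟩) P := by
    refine ⟨hx1, hx2, ?_, congrArg (· ^ 2) hy2, congrArg₂ (· * ·) hy1 hy2⟩
    rw [← sq_eq_sq₀ (jacobiData hk.le ⟨x, y⟩).δ_pos.le P.δ_pos.le, P.δ_sq, JacobiData.δ_sq, ← hy1]
    rfl
  exact ⟨⟨x, y⟩, hE.sn_eq.trans hw, hE.cn_mul_dn_eq.trans hp⟩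

theorem ellipticF_zero (φ : ℝ) : ellipticF 0 φ = φ := by
  simp [ellipticF]

theorem jacobiAm_zero (u : ℝ) : jacobiAm 0 u = u := by
  rw [← ellipticF_zero (jacobiAm 0 u), ellipticF_jacobiAm (by simp)]

theorem coModulus_of_abs_eq_one {k : ℝ} (hk : |k| = 1) : coModulus k = 0 := by
  rw [coModulus, ← sq_abs, hk]
  simp

/-- For modulus `±1` the function `sn` is the hyperbolic tangent. -/
theorem snAux_of_abs_eq_one {k : ℝ} (hk : |k| = 1) (z : ℂ) (hz : Complex.cosh z ≠ 0) :
    snAux k z = Complex.tanh z := by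
  obtain ⟨x, y⟩ := z
  have hk2 : k ^ 2 = 1 := by rw [← sq_abs, hk, one_pow]
  have hH := Real.cosh_pos x
  have hHS := Real.cosh_sq x
  have hcs := Real.sin_sq_add_cos_sq y
  have hxy : (⟨x, y⟩ : ℂ) = x + y * Complex.I := Complex.mk_eq_add_mul_I x y
  rw [Complex.tanh_eq_sinh_div_cosh]
  rw [hxy, Complex.cosh_add, Complex.cosh_mul_I, Complex.sinh_mul_I] at hz
  nth_rewrite 2 [hxy]
  nth_rewrite 2 [hxy]
  rw [Complex.sinh_add, Complex.cosh_add, Complex.cosh_mul_I, Complex.sinh_mul_I]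
  rw [← Complex.ofReal_cosh, ← Complex.ofReal_sinh, ← Complex.ofReal_cos, ← Complex.ofReal_sin] at *
  simp only [snAux, jacobiDen, realSn_of_abs_eq_one hk, realCn_of_abs_eq_one hk,
    realDn_of_abs_eq_one hk, coModulus_of_abs_eq_one hk, hk2, Real.tanh_eq_sinh_div_cosh]
  simp only [realDn, realSn, realCn, jacobiAm_zero]
  generalize Real.cosh x = H at *
  generalize Real.sinh x = S at *
  generalize Real.sin y = σ at *
  generalize Real.cos y = χ at *
  have hD : χ ^ 2 + 1 * (S / H) ^ 2 * σ ^ 2 ≠ 0 := by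
    intro h0
    have h1 : (H * χ) ^ 2 + (S * σ) ^ 2 = 0 := by
      field_simp at h0
      linear_combination h0
    have h2 : H * χ = 0 := by nlinarith [sq_nonneg (H * χ), sq_nonneg (S * σ)]
    have h3 : S * σ = 0 := by nlinarith [sq_nonneg (H * χ), sq_nonneg (S * σ)]
    apply hz
    rw [← mul_assoc, ← Complex.ofReal_mul, ← Complex.ofReal_mul, h2, h3]
    simp
  have hH' : (H : ℂ) ≠ 0 := Complex.ofReal_ne_zero.2 hH.ne'
  have hI := Complex.I_sq
  have g1 : (H : ℂ) ^ 2 = S ^ 2 + 1 := by exact_mod_cast hHS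
  have g2 : (σ : ℂ) ^ 2 + χ ^ 2 = 1 := by exact_mod_cast hcs
  rw [div_eq_div_iff (Complex.ofReal_ne_zero.2 hD) hz]
  push_cast
  simp only [ne_eq, OfNat.ofNat_ne_zero, not_false_eq_true, zero_pow, zero_mul, sub_zero,
    Real.sqrt_one, Complex.ofReal_one]
  field_simp
  clear hz hD hH hH' hxy hHS hcs hk2 hk
  grind

theorem cnAux_mul_dnAux_of_abs_eq_one {k : ℝ} (hk : |k| = 1) {z : ℂ} (hz : snAux k z ≠ 0) :
    cnAux k z * dnAux k z = 1 - snAux k z ^ 2 := by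
  have h : cnAux k z = dnAux k z := by
    have hk2 : k ^ 2 = 1 := by rw [← sq_abs, hk, one_pow]
    simp only [cnAux, dnAux, realSn_of_abs_eq_one hk, realCn_of_abs_eq_one hk,
      realDn_of_abs_eq_one hk, coModulus_of_abs_eq_one hk, hk2]
    simp [realDn]
  have hD := (jacobiData hk.le z).den_ne_zero_of_sn_ne_zero hz
  have h1 := (jacobiData hk.le z).sn_sq_add_cn_sq hD
  rw [← snAux_eq, ← cnAux_eq] at h1
  rw [← h]
  linear_combination h1

theorem exists_snAux_eq_of_abs_eq_one {k : ℝ} (hk : |k| = 1) {w : ℂ} (hw : w ^ 2 ≠ 1) :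
    ∃ z, snAux k z = w := by
  have h1 : 1 + w ≠ 0 := fun h => hw (by linear_combination (w - 1) * h)
  have h2 : 1 - w ≠ 0 := fun h => hw (by linear_combination -(w + 1) * h)
  set z := Complex.log ((1 + w) / (1 - w)) / 2 with hz
  have he : Complex.exp z * Complex.exp z * (1 - w) = 1 + w := by
    rw [← Complex.exp_add, hz, add_halves, Complex.exp_log (div_ne_zero h1 h2)]
    field_simp
  have hinv : Complex.exp z * Complex.exp (-z) = 1 := by
    rw [← Complex.exp_add, add_neg_cancel, Complex.exp_zero]
  have hs : 2 * Complex.sinh z = _ := Complex.two_sinh z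
  have hc : 2 * Complex.cosh z = _ := Complex.two_cosh z
  have hc' : Complex.cosh z * Complex.exp z * (1 - w) = 1 := by
    linear_combination (1 / 2 : ℂ) * Complex.exp z * (1 - w) * hc + (1 / 2 : ℂ) * he +
      (1 / 2 : ℂ) * (1 - w) * hinv
  have hc0 : Complex.cosh z ≠ 0 := fun h => by simp [h] at hc'
  refine ⟨z, ?_⟩
  rw [snAux_of_abs_eq_one hk z hc0, Complex.tanh_eq_sinh_div_cosh, div_eq_iff hc0]
  refine mul_left_cancel₀ (mul_ne_zero two_ne_zero (Complex.exp_ne_zero z)) ?_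
  linear_combination Complex.exp z * hs - w * Complex.exp z * hc + he - (1 + w) * hinv

/-! ### Arbitrary real modulus -/

theorem abs_inv_abs_le_one {k : ℝ} (hk : ¬ |k| ≤ 1) : |(|k|⁻¹)| ≤ 1 := by
  rw [abs_inv, abs_abs]
  exact inv_le_one_of_one_le₀ (not_le.1 hk).le

theorem jacobiSn_eq_snAux_div {k : ℝ} (hk : ¬ |k| ≤ 1) (z : ℂ) :
    jacobiSn k z = snAux |k|⁻¹ (|k| * z) / |k| := if_neg hk

theorem jacobiCn_mul_jacobiDn_eq {k : ℝ} (hk : ¬ |k| ≤ 1) (z : ℂ) :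
    jacobiCn k z * jacobiDn k z = cnAux |k|⁻¹ (|k| * z) * dnAux |k|⁻¹ (|k| * z) := by
  rw [jacobiCn, jacobiDn, if_neg hk, if_neg hk, mul_comm]

theorem jacobiSn_of_abs_le {k : ℝ} (hk : |k| ≤ 1) (z : ℂ) : jacobiSn k z = snAux k z := if_pos hk

theorem jacobiCn_mul_jacobiDn_of_abs_le {k : ℝ} (hk : |k| ≤ 1) (z : ℂ) :
    jacobiCn k z * jacobiDn k z = cnAux k z * dnAux k z := by
  rw [jacobiCn, jacobiDn, if_pos hk, if_pos hk]

section

variable {k : ℝ} (hk0 : k ≠ 0)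
include hk0

theorem ofReal_abs_ne_zero : ((|k| : ℝ) : ℂ) ≠ 0 := by simpa using hk0

theorem jacobiCn_mul_jacobiDn_sq {z : ℂ} (h : jacobiSn k z ≠ 0) :
    (jacobiCn k z * jacobiDn k z) ^ 2 =
      (1 - jacobiSn k z ^ 2) * (1 - k ^ 2 * jacobiSn k z ^ 2) := by
  have hk' := ofReal_abs_ne_zero hk0
  have gk : ((|k| : ℝ) : ℂ) ^ 2 = k ^ 2 := by exact_mod_cast sq_abs k
  by_cases hk : |k| ≤ 1
  · rw [jacobiSn_of_abs_le hk] at h ⊢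
    rw [jacobiCn_mul_jacobiDn_of_abs_le hk, cnAux_mul_dnAux_sq hk h]
  · rw [jacobiSn_eq_snAux_div hk] at h ⊢
    rw [jacobiCn_mul_jacobiDn_eq hk, cnAux_mul_dnAux_sq (abs_inv_abs_le_one hk)
      (div_ne_zero_iff.1 h).1, ← gk]
    push_cast
    field_simp

theorem hasDerivAt_jacobiSn (b : ℝ) (z : ℂ) (t : ℝ) (h : jacobiSn k (b * t + z) ≠ 0) :
    HasDerivAt (fun t : ℝ => jacobiSn k (b * t + z))
      (b * (jacobiCn k (b * t + z) * jacobiDn k (b * t + z))) t := by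
  by_cases hk : |k| ≤ 1
  · simp only [jacobiSn_of_abs_le hk] at h ⊢
    rw [jacobiCn_mul_jacobiDn_of_abs_le hk]
    exact hasDerivAt_snAux hk b z t h
  · have hk' := ofReal_abs_ne_zero hk0
    have harg : ∀ t : ℝ, ((|k| : ℝ) : ℂ) * (b * t + z) = (|k| * b : ℝ) * t + |k| * z := fun t => by
      push_cast; ring
    simp only [jacobiSn_eq_snAux_div hk, jacobiCn_mul_jacobiDn_eq hk, harg] at h ⊢
    refine ((hasDerivAt_snAux (abs_inv_abs_le_one hk) _ _ t (div_ne_zero_iff.1 h).1).div_const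
      _).congr_deriv ?_
    push_cast
    field_simp

theorem hasDerivAt_jacobiCn_mul_jacobiDn (b : ℝ) (z : ℂ) (t : ℝ)
    (h : jacobiSn k (b * t + z) ≠ 0) :
    HasDerivAt (fun t : ℝ => jacobiCn k (b * t + z) * jacobiDn k (b * t + z))
      (b * (-(1 + k ^ 2) * jacobiSn k (b * t + z) + 2 * k ^ 2 * jacobiSn k (b * t + z) ^ 3)) t := by
  by_cases hk : |k| ≤ 1
  · simp only [jacobiSn_of_abs_le hk, jacobiCn_mul_jacobiDn_of_abs_le hk] at h ⊢
    exact hasDerivAt_cnAux_mul_dnAux hk b z t h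
  · have hk' := ofReal_abs_ne_zero hk0
    have gk : ((|k| : ℝ) : ℂ) ^ 2 = k ^ 2 := by exact_mod_cast sq_abs k
    have harg : ∀ t : ℝ, ((|k| : ℝ) : ℂ) * (b * t + z) = (|k| * b : ℝ) * t + |k| * z := fun t => by
      push_cast; ring
    simp only [jacobiSn_eq_snAux_div hk, jacobiCn_mul_jacobiDn_eq hk, harg] at h ⊢
    refine (hasDerivAt_cnAux_mul_dnAux (abs_inv_abs_le_one hk) _ _ t
      (div_ne_zero_iff.1 h).1).congr_deriv ?_
    rw [← gk]
    push_cast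
    field_simp
    ring

/-- The relations `sn z₀ sn z₁ = 1 / |k|` and `(cn dn)(z₀) + |k| sn² z₀ (cn dn)(z₁) = 0` persist at
all real translates. -/
theorem jacobiSn_add_of_jacobiSn_mul_eq {z₀ z₁ : ℂ}
    (h : |k| * (jacobiSn k z₀ * jacobiSn k z₁) = 1)
    (hp : jacobiCn k z₀ * jacobiDn k z₀ +
      |k| * jacobiSn k z₀ ^ 2 * (jacobiCn k z₁ * jacobiDn k z₁) = 0)
    (t : ℝ) (ht : jacobiSn k (t + z₀) ≠ 0) :
    |k| * (jacobiSn k (t + z₀) * jacobiSn k (t + z₁)) = 1 ∧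
    jacobiCn k (t + z₀) * jacobiDn k (t + z₀) +
      |k| * jacobiSn k (t + z₀) ^ 2 * (jacobiCn k (t + z₁) * jacobiDn k (t + z₁)) = 0 := by
  by_cases hk : |k| ≤ 1
  · simp only [jacobiSn_of_abs_le hk, jacobiCn_mul_jacobiDn_of_abs_le hk] at *
    exact snAux_add_of_snAux_mul_eq hk hk0 h hp t ht
  · have hk' := ofReal_abs_ne_zero hk0
    have harg : ∀ z : ℂ, ((|k| : ℝ) : ℂ) * (t + z) = (|k| * t : ℝ) + |k| * z := fun z => by
      push_cast; ring
    simp only [jacobiSn_eq_snAux_div hk, jacobiCn_mul_jacobiDn_eq hk, harg] at *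
    have hinv : ((|(|k|⁻¹)| : ℝ) : ℂ) = ((|k| : ℝ) : ℂ)⁻¹ := by
      rw [abs_inv, abs_abs, Complex.ofReal_inv]
    have := snAux_add_of_snAux_mul_eq (abs_inv_abs_le_one hk) (inv_ne_zero (abs_ne_zero.2 hk0))
      (z₀ := |k| * z₀) (z₁ := |k| * z₁) (by rw [hinv, ← h]; field_simp)
      (by rw [hinv, ← hp]; field_simp) (|k| * t) (div_ne_zero_iff.1 ht).1
    rw [hinv] at this
    refine ⟨?_, ?_⟩
    · rw [← this.1]; field_simp
    · rw [← this.2]; field_simp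

theorem exists_jacobiSn_eq (hk1 : |k| ≠ 1) {w p : ℂ}
    (h : p ^ 2 = (1 - w ^ 2) * (1 - k ^ 2 * w ^ 2)) :
    ∃ z, jacobiSn k z = w ∧ jacobiCn k z * jacobiDn k z = p := by
  by_cases hk : |k| ≤ 1
  · simp only [jacobiSn_of_abs_le hk, jacobiCn_mul_jacobiDn_of_abs_le hk]
    exact exists_snAux_eq_of_lt (lt_of_le_of_ne hk hk1) hk0 h
  · have hk' := ofReal_abs_ne_zero hk0
    have gk : ((|k| : ℝ) : ℂ) ^ 2 = k ^ 2 := by exact_mod_cast sq_abs k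
    simp only [jacobiSn_eq_snAux_div hk, jacobiCn_mul_jacobiDn_eq hk]
    have hlt : |(|k|⁻¹)| < 1 := by
      rw [abs_inv, abs_abs]
      exact inv_lt_one_of_one_lt₀ (not_le.1 hk)
    obtain ⟨z, hz, hz'⟩ := exists_snAux_eq_of_lt hlt (inv_ne_zero (abs_ne_zero.2 hk0))
      (w := |k| * w) (p := p) (by rw [h, ← gk]; push_cast; field_simp)
    refine ⟨z / |k|, ?_, ?_⟩
    · rw [mul_div_cancel₀ _ hk', hz]; field_simp
    · rw [mul_div_cancel₀ _ hk', hz']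

end

/-! ### Admissible phases -/

/-- If `k ≠ -1`, two points on the curve `p² = (1 - w²)(1 - k² w²)` lift to `c 0` and `c 1`. If
`k = -1`, then `sn = tanh` omits the values `±1`, and the relation for `cn dn` is automatic. -/
theorem exists_isPhase {k : ℝ} (hk : k < 0) (a : ℂ) (h : k ≠ -1 ∨ Complex.exp (2 * a) ≠ 1) :
    ∃ c : ℤ → ℂ, IsPhase k a c := by
  have habs : |k| = -k := abs_of_neg hk
  set r : ℂ := ((Real.sqrt (-k) : ℝ) : ℂ) with hr
  have hr2 : r ^ 2 = -k := by
    rw [hr, ← Complex.ofReal_pow, Real.sq_sqrt (by linarith)]; push_cast; rfl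
  have hr0 : r ≠ 0 := by
    rw [hr]; exact Complex.ofReal_ne_zero.2 (Real.sqrt_pos.2 (by linarith)).ne'
  have hee : Complex.exp a * Complex.exp (-a) = 1 := by
    rw [← Complex.exp_add, add_neg_cancel, Complex.exp_zero]
  have hea := Complex.exp_ne_zero a
  suffices hz : ∃ z₀ z₁, jacobiSn k z₀ = Complex.exp a / r ∧ jacobiSn k z₁ = Complex.exp (-a) / r ∧
      jacobiCn k z₀ * jacobiDn k z₀ +
        |k| * jacobiSn k z₀ ^ 2 * (jacobiCn k z₁ * jacobiDn k z₁) = 0 by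
    obtain ⟨z₀, z₁, h0, h1, hp⟩ := hz
    have hev : ∀ n : ℤ, (if Even (2 * n) then z₀ else z₁) = z₀ := fun n => if_pos (even_two_mul n)
    have hod : ∀ n : ℤ, (if Even (2 * n + 1) then z₀ else z₁) = z₁ := fun n =>
      if_neg (Int.not_even_two_mul_add_one n)
    refine ⟨fun n => if Even n then z₀ else z₁, ?_, ?_, ?_, ?_⟩
    · intro n
      simp only [Int.even_add, even_two, iff_true]
    · intro n
      rw [hev, h0]
    · intro n
      rw [hod, h1]
    · simpa using hp
  by_cases hk1 : k = -1
  · have ha : Complex.exp (2 * a) ≠ 1 := h.resolve_left (not_not.2 hk1)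
    have hk1' : |k| = 1 := by rw [habs, hk1, neg_neg]
    have hrsq : r ^ 2 = 1 := by rw [hr2, hk1]; norm_num
    have h2a : Complex.exp (2 * a) = Complex.exp a ^ 2 := by rw [two_mul, Complex.exp_add, sq]
    rw [h2a] at ha
    obtain ⟨z₀, h0⟩ := exists_snAux_eq_of_abs_eq_one hk1' (w := Complex.exp a / r)
      (by rw [div_pow, hrsq, div_one]; exact ha)
    obtain ⟨z₁, h1⟩ := exists_snAux_eq_of_abs_eq_one hk1' (w := Complex.exp (-a) / r) (by
      rw [div_pow, hrsq, div_one]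
      intro h1
      apply ha
      linear_combination (-Complex.exp a ^ 2) * h1 + (Complex.exp a * Complex.exp (-a) + 1) * hee)
    refine ⟨z₀, z₁, ?_, ?_, ?_⟩
    · rw [jacobiSn_of_abs_le hk1'.le, h0]
    · rw [jacobiSn_of_abs_le hk1'.le, h1]
    · rw [jacobiSn_of_abs_le hk1'.le, jacobiCn_mul_jacobiDn_of_abs_le hk1'.le,
        jacobiCn_mul_jacobiDn_of_abs_le hk1'.le, cnAux_mul_dnAux_of_abs_eq_one hk1' (by
          rw [h0]; exact div_ne_zero hea hr0),
        cnAux_mul_dnAux_of_abs_eq_one hk1' (by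
          rw [h1]; exact div_ne_zero (Complex.exp_ne_zero _) hr0), h0, h1, hk1']
      rw [div_pow, div_pow, hrsq]
      push_cast
      linear_combination (-(Complex.exp a * Complex.exp (-a) + 1)) * hee
  · have hk1' : |k| ≠ 1 := by
      rw [habs]; intro h'; apply hk1; linarith
    set w := Complex.exp a / r with hw
    have hw0 : w ≠ 0 := div_ne_zero hea hr0
    have hw1 : Complex.exp (-a) / r = 1 / (|k| * w) := by
      rw [Complex.exp_neg, hw, habs]
      push_cast
      rw [← hr2]
      field_simp
    obtain ⟨p, hp⟩ := IsAlgClosed.exists_pow_nat_eq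
      ((1 - w ^ 2) * (1 - k ^ 2 * w ^ 2)) (n := 2) two_pos
    have gk : ((|k| : ℝ) : ℂ) ^ 2 = k ^ 2 := by exact_mod_cast sq_abs k
    have hk' := ofReal_abs_ne_zero hk.ne
    obtain ⟨z₀, h0, h0'⟩ := exists_jacobiSn_eq hk.ne hk1' (w := w) (p := p) hp
    obtain ⟨z₁, h1, h1'⟩ := exists_jacobiSn_eq hk.ne hk1' (w := 1 / (|k| * w))
      (p := -p / (|k| * w ^ 2)) (by
        rw [div_pow, neg_sq, hp, ← gk]
        field_simp
        ring)
    refine ⟨z₀, z₁, h0, by rw [h1, hw1], ?_⟩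
    rw [h0', h1', h0]
    field_simp
    ring

/-! ### Relativistic Toda lattice -/

/-- A continuous branch of the logarithm of a differentiable function is differentiable. -/
theorem hasDerivAt_of_exp_eq {ℓ E : ℝ → ℂ} {E' : ℂ} {t : ℝ} (hc : ContinuousAt ℓ t)
    (he : ∀ᶠ s in nhds t, Complex.exp (ℓ s) = E s) (hE : HasDerivAt E E' t) :
    HasDerivAt ℓ (E' / E t) t := by
  have het := he.self_of_nhds
  have hEt : E t ≠ 0 := het ▸ Complex.exp_ne_zero _
  have hlog : HasDerivAt (fun s => ℓ t + Complex.log (E s / E t)) (E' / E t) t := by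
    have h := (hE.div_const (E t)).clog_real (by rw [div_self hEt]; exact Complex.one_mem_slitPlane)
    rw [div_self hEt, div_one] at h
    exact h.const_add _
  refine hlog.congr_of_eventuallyEq ?_
  -- near `t` the imaginary part of `ℓ s - ℓ t` is small, so the principal branch applies
  have him : ContinuousAt (fun s => (ℓ s - ℓ t).im) t :=
    Complex.continuous_im.continuousAt.comp (hc.sub continuousAt_const)
  have h0 : (ℓ t - ℓ t).im ∈ Set.Ioo (-Real.pi) Real.pi := by
    simp [Real.pi_pos]
  filter_upwards [he, him.eventually (isOpen_Ioo.mem_nhds h0)] with s hs hsi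
  rw [← hs, ← het, ← Complex.exp_sub, Complex.log_exp hsi.1 hsi.2.le]
  ring

/-- The substitution expressing `u`, `v` through `x` turns the first order lattice into the second
order one. -/
theorem solvesRuijsenaarsTodaAt_of_solvesRTLAt {h : ℝ} (hh : 0 < h) {U : Set ℝ} (hU : IsOpen U)
    {x u v : ℤ → ℝ → ℂ} (hlat : ∀ n, ∀ t ∈ U, SolvesRTLAt u v n t) (hv : ∀ n, ∀ t ∈ U, v n t ≠ 0)
    (huv : ∀ n, ∀ t ∈ U, u n t + v n t ≠ 0)
    (hexp : ∀ n, ∀ t ∈ U,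
      Complex.exp (x n t - x (n + 1) t) = u n t / v n t * (1 / (h : ℂ) ^ 2))
    (hx : ∀ n, ∀ t ∈ U, HasDerivAt (x n) (u n t + v n t - 1 / h) t) (n : ℤ) {t : ℝ} (ht : t ∈ U) :
    SubstitutionAt h x u v n t ∧ SolvesRuijsenaarsTodaAt h x n t := by
  have hh' : (h : ℂ) ≠ 0 := Complex.ofReal_ne_zero.2 hh.ne'
  have hden : ∀ n, 1 + (h : ℂ) ^ 2 * Complex.exp (x n t - x (n + 1) t) =
      (u n t + v n t) / v n t := by
    intro n
    have := hv n t ht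
    rw [hexp n t ht]
    field_simp
    ring
  have hden0 : ∀ n, 1 + (h : ℂ) ^ 2 * Complex.exp (x n t - x (n + 1) t) ≠ 0 := fun n => by
    rw [hden]; exact div_ne_zero (huv n t ht) (hv n t ht)
  have hder : ∀ n, 1 + h * deriv (x n) t = h * (u n t + v n t) := fun n => by
    rw [(hx n t ht).deriv]; field_simp; ring
  have hn1 := hv n t ht
  have hn2 := huv n t ht
  have hp : n - 1 + 1 = n := by ring
  refine ⟨⟨(hx n t ht).differentiableAt, hden0 n, ?_, ?_⟩, (hx (n - 1) t ht).differentiableAt,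
    (hx n t ht).differentiableAt, (hx (n + 1) t ht).differentiableAt, ?_, hden0 n, ?_⟩
  · rw [hden, hexp n t ht, hder]
    field_simp
  · rw [hden, hder]
    field_simp
  · have := hden0 (n - 1)
    rwa [hp] at this
  · have hm1 := hv (n - 1) t ht
    have hm2 := huv (n - 1) t ht
    have hdm := hden (n - 1)
    have hem := hexp (n - 1) t ht
    rw [hp] at hdm hem
    have hd : HasDerivAt (fun s => u n s + v n s - 1 / h) _ t :=
      ((hlat n t ht).1.add (hlat n t ht).2).sub_const _
    have heq : deriv (x n) =ᶠ[nhds t] fun s => u n s + v n s - 1 / h := by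
      filter_upwards [hU.mem_nhds ht] with s hs
      exact (hx n s hs).deriv
    refine (hd.congr_of_eventuallyEq heq).congr_deriv ?_
    rw [hdm, hden, hem, hexp n t ht, hder, hder, hder]
    field_simp
    ring

/-! ### The periodic solution -/

theorem IsPhase.periodic_two_mul {k : ℝ} {a : ℂ} {c : ℤ → ℂ} (hc : IsPhase k a c) (n m : ℤ) :
    c (n + 2 * m) = c n := by
  have h : Function.Periodic c 2 := hc.periodic
  simpa [mul_comm] using h.int_mul m n

/-- The relations between neighbouring sites hold at time `0` by admissibility, hence at all
times. -/
theorem IsPhase.rel {k : ℝ} {a : ℂ} {c : ℤ → ℂ} (hc : IsPhase k a c) (hk : k < 0) (l2 : ℝ) (n : ℤ)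
    (t : ℝ) (ht : jacobiSn k (phaseArg l2 c n t) ≠ 0) :
    |k| * (jacobiSn k (phaseArg l2 c n t) * jacobiSn k (phaseArg l2 c (n + 1) t)) = 1 ∧
    jacobiCn k (phaseArg l2 c n t) * jacobiDn k (phaseArg l2 c n t) +
      |k| * jacobiSn k (phaseArg l2 c n t) ^ 2 *
        (jacobiCn k (phaseArg l2 c (n + 1) t) * jacobiDn k (phaseArg l2 c (n + 1) t)) = 0 := by
  have h0 : jacobiSn k (c 0) = _ := hc.sn_even 0
  have h1 : jacobiSn k (c 1) = _ := hc.sn_odd 0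
  have hr2 : ((Real.sqrt (-k) : ℝ) : ℂ) ^ 2 = |k| := by
    rw [← Complex.ofReal_pow, Real.sq_sqrt (by linarith), abs_of_neg hk]
  have hr0 : ((Real.sqrt (-k) : ℝ) : ℂ) ≠ 0 :=
    Complex.ofReal_ne_zero.2 (Real.sqrt_pos.2 (by linarith)).ne'
  have hprod : |k| * (jacobiSn k (c 0) * jacobiSn k (c 1)) = 1 := by
    rw [h0, h1, ← hr2, Complex.exp_neg]
    have := Complex.exp_ne_zero a
    field_simp
  have harg : ∀ m, phaseArg l2 c m t = (l2 * t : ℝ) + c m := fun m => by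
    rw [phaseArg]; push_cast; rfl
  simp only [harg] at ht ⊢
  obtain ⟨m, rfl | rfl⟩ := Int.even_or_odd' n
  · rw [show 2 * m + 1 = 1 + 2 * m by ring, hc.periodic_two_mul 1 m,
      show 2 * m = 0 + 2 * m by ring, hc.periodic_two_mul 0 m] at *
    exact jacobiSn_add_of_jacobiSn_mul_eq hk.ne hprod hc.cn_dn _ ht
  · rw [show 2 * m + 1 + 1 = 0 + 2 * (m + 1) by ring, hc.periodic_two_mul 0 (m + 1),
      show 2 * m + 1 = 1 + 2 * m by ring, hc.periodic_two_mul 1 m] at *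
    -- both relations are symmetric in the two points
    refine jacobiSn_add_of_jacobiSn_mul_eq hk.ne (by rw [← hprod]; ring) ?_ _ ht
    have h2 : |k| * jacobiSn k (c 1) ^ 2 * (|k| * jacobiSn k (c 0) ^ 2) = 1 := by
      linear_combination ((|k| : ℝ) * (jacobiSn k (c 0) * jacobiSn k (c 1)) + 1) * hprod
    linear_combination (|k| : ℝ) * jacobiSn k (c 1) ^ 2 * hc.cn_dn -
      (jacobiCn k (c 1) * jacobiDn k (c 1)) * h2

theorem IsPhase.jacobiSn_succ_ne_zero {k : ℝ} {a : ℂ} {c : ℤ → ℂ} (hc : IsPhase k a c) (hk : k < 0)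
    (l2 : ℝ) (n : ℤ) (t : ℝ) (ht : jacobiSn k (phaseArg l2 c n t) ≠ 0) :
    jacobiSn k (phaseArg l2 c (n + 1) t) ≠ 0 := by
  intro h
  have := (hc.rel hk l2 n t ht).1
  rw [h] at this
  simp at this

/-- The values at the site `n + 1` in terms of those at `n`. -/
theorem IsPhase.jacobi_succ_eq {k : ℝ} {a : ℂ} {c : ℤ → ℂ} (hc : IsPhase k a c) (hk : k < 0)
    (l2 : ℝ) (n : ℤ) (t : ℝ) (ht : jacobiSn k (phaseArg l2 c n t) ≠ 0) :
    jacobiSn k (phaseArg l2 c (n + 1) t) = 1 / (|k| * jacobiSn k (phaseArg l2 c n t)) ∧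
    jacobiCn k (phaseArg l2 c (n + 1) t) * jacobiDn k (phaseArg l2 c (n + 1) t) =
      -(jacobiCn k (phaseArg l2 c n t) * jacobiDn k (phaseArg l2 c n t)) /
        (|k| * jacobiSn k (phaseArg l2 c n t) ^ 2) := by
  obtain ⟨h1, h2⟩ := hc.rel hk l2 n t ht
  have hk' := ofReal_abs_ne_zero hk.ne
  refine ⟨?_, ?_⟩
  · rw [eq_div_iff (mul_ne_zero hk' ht)]
    linear_combination h1
  · rw [eq_div_iff (mul_ne_zero hk' (pow_ne_zero 2 ht))]
    linear_combination h2

theorem IsPhase.phaseArg_add_two_mul {k : ℝ} {a : ℂ} {c : ℤ → ℂ} (hc : IsPhase k a c) (l2 : ℝ)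
    (n m : ℤ) (t : ℝ) : phaseArg l2 c (n + 2 * m) t = phaseArg l2 c n t := by
  rw [phaseArg, phaseArg, hc.periodic_two_mul]

theorem IsPhase.periodicU_add_two_mul {l1 l2 : ℝ} {a : ℂ} {c : ℤ → ℂ} (hc : IsPhase (l1 / l2) a c)
    (n m : ℤ) : periodicU l1 l2 c (n + 2 * m) = periodicU l1 l2 c n := by
  funext t
  simp only [periodicU, hc.phaseArg_add_two_mul]

theorem IsPhase.periodicV_add_two_mul {l1 l2 : ℝ} {a : ℂ} {c : ℤ → ℂ} (hc : IsPhase (l1 / l2) a c)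
    (n m : ℤ) : periodicV l1 l2 c (n + 2 * m) = periodicV l1 l2 c n := by
  funext t
  simp only [periodicV, hc.phaseArg_add_two_mul]

section

variable {l1 l2 : ℝ} {a : ℂ} {c : ℤ → ℂ} (hk : l1 / l2 < 0)
include hk

theorem hasDerivAt_periodicGamma (n : ℤ) (t : ℝ)
    (ht : jacobiSn (l1 / l2) (phaseArg l2 c n t) ≠ 0) :
    HasDerivAt (periodicGamma l1 l2 c n)
      (l1 * (l2 * (jacobiCn (l1 / l2) (phaseArg l2 c n t) *
        jacobiDn (l1 / l2) (phaseArg l2 c n t)))) t :=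
  (hasDerivAt_jacobiSn hk.ne l2 (c n) t ht).const_mul (l1 : ℂ)

theorem ne_zero_of_div_neg : (l1 : ℂ) ≠ 0 ∧ (l2 : ℂ) ≠ 0 := by
  constructor <;> refine Complex.ofReal_ne_zero.2 ?_ <;> rintro rfl <;> simp at hk

theorem deriv_periodicGamma_sq (n : ℤ) (t : ℝ)
    (ht : jacobiSn (l1 / l2) (phaseArg l2 c n t) ≠ 0) : deriv (periodicGamma l1 l2 c n) t ^ 2 =
    (periodicGamma l1 l2 c n t - l1) * (periodicGamma l1 l2 c n t - l2) *
      (periodicGamma l1 l2 c n t - (-l1 : ℝ)) * (periodicGamma l1 l2 c n t - (-l2 : ℝ)) := by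
  have hsq := jacobiCn_mul_jacobiDn_sq hk.ne ht
  have h2 := (ne_zero_of_div_neg hk).2
  rw [(hasDerivAt_periodicGamma hk n t ht).deriv, mul_pow, mul_pow, hsq, periodicGamma]
  push_cast
  field_simp
  ring
theorem ofReal_eq_neg_abs_mul : (l1 : ℂ) = -(|l1 / l2| : ℝ) * l2 := by
  have h2 := (ne_zero_of_div_neg hk).2
  rw [abs_of_neg hk]
  push_cast
  field_simp

variable (hc : IsPhase (l1 / l2) a c) (n : ℤ) (t : ℝ)
  (ht : jacobiSn (l1 / l2) (phaseArg l2 c n t) ≠ 0)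
include hc ht

theorem IsPhase.solvesRTLAt :
    SolvesRTLAt (periodicU l1 l2 c) (periodicV l1 l2 c) n t := by
  have hk' := ofReal_abs_ne_zero hk.ne
  have gk : ((|l1 / l2| : ℝ) : ℂ) ^ 2 = ((l1 / l2 : ℝ) : ℂ) ^ 2 := by
    exact_mod_cast sq_abs (l1 / l2)
  have hS : HasDerivAt (fun t => jacobiSn (l1 / l2) (phaseArg l2 c n t)) _ t :=
    hasDerivAt_jacobiSn hk.ne l2 (c n) t ht
  have hP : HasDerivAt (fun t => jacobiCn (l1 / l2) (phaseArg l2 c n t) *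
      jacobiDn (l1 / l2) (phaseArg l2 c n t)) _ t :=
    hasDerivAt_jacobiCn_mul_jacobiDn hk.ne l2 (c n) t ht
  have hsq := jacobiCn_mul_jacobiDn_sq hk.ne ht
  obtain ⟨h1, h2⟩ := hc.jacobi_succ_eq hk l2 n t ht
  have hprev : phaseArg l2 c (n - 1) t = phaseArg l2 c (n + 1) t := by
    rw [← hc.phaseArg_add_two_mul l2 (n - 1) 1 t]
    congr 1
    ring
  have hU : HasDerivAt (periodicU l1 l2 c n) _ t :=
    ((hS.const_mul ((|l1 / l2| : ℝ) : ℂ)).add ((hP.add_const 1).div hS ht)).const_mul ((l2 : ℂ) / 2)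
  have hV : HasDerivAt (periodicV l1 l2 c n) _ t := (hasDerivAt_const t (-(l2 : ℂ))).div hS ht
  have hpa : phaseArg l2 c n t = l2 * t + c n := rfl
  rw [← hpa] at hU hV
  refine ⟨hU.congr_deriv ?_, hV.congr_deriv ?_⟩
  · simp only [periodicU, periodicV, hprev, h1, h2]
    rw [← gk] at hsq ⊢
    generalize jacobiCn (l1 / l2) (phaseArg l2 c n t) * jacobiDn (l1 / l2) (phaseArg l2 c n t) = P
      at *
    generalize jacobiSn (l1 / l2) (phaseArg l2 c n t) = S at *
    generalize ((|l1 / l2| : ℝ) : ℂ) = κ at *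
    field_simp
    linear_combination (-2 * (l2 : ℂ) ^ 2) * hsq
  · simp only [periodicU, periodicV, hprev, h1, h2]
    field_simp
    ring

end

section

variable {l1 l2 : ℝ} {a : ℂ} {c : ℤ → ℂ} (hk : l1 / l2 < 0)
include hk

theorem periodicV_eq_div_periodicGamma (n : ℤ) (t : ℝ) :
    periodicV l1 l2 c n t = -(l1 * l2) / periodicGamma l1 l2 c n t := by
  rw [periodicV, periodicGamma, ← mul_neg, mul_div_mul_left _ _ (ne_zero_of_div_neg hk).1]

theorem periodicU_eq_periodicGamma (n : ℤ) (t : ℝ)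
    (ht : jacobiSn (l1 / l2) (phaseArg l2 c n t) ≠ 0) :
    periodicU l1 l2 c n t = -(1 / 2) * (periodicGamma l1 l2 c n t -
      deriv (periodicGamma l1 l2 c n) t / periodicGamma l1 l2 c n t -
      l1 * l2 / periodicGamma l1 l2 c n t) := by
  rw [(hasDerivAt_periodicGamma hk n t ht).deriv, periodicGamma, periodicU,
    mul_div_mul_left _ _ (ne_zero_of_div_neg hk).1, mul_div_mul_left _ _ (ne_zero_of_div_neg hk).1]
  have h := ofReal_eq_neg_abs_mul hk
  field_simp
  rw [h]
  ring

theorem periodicGamma_succ (hc : IsPhase (l1 / l2) a c) (n : ℤ) (t : ℝ)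
    (ht : jacobiSn (l1 / l2) (phaseArg l2 c n t) ≠ 0) :
    periodicGamma l1 l2 c (n + 1) t = -(l1 * l2) / periodicGamma l1 l2 c n t := by
  have hk' := ofReal_abs_ne_zero hk.ne
  have h2 := (ne_zero_of_div_neg hk).2
  rw [periodicGamma, periodicGamma, (hc.jacobi_succ_eq hk l2 n t ht).1, ofReal_eq_neg_abs_mul hk]
  field_simp

theorem periodicV_ne_zero (n : ℤ) (t : ℝ) (ht : jacobiSn (l1 / l2) (phaseArg l2 c n t) ≠ 0) :
    periodicV l1 l2 c n t ≠ 0 :=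
  div_ne_zero (neg_ne_zero.2 (ne_zero_of_div_neg hk).2) ht

theorem periodicU_div_periodicV (n : ℤ) (t : ℝ)
    (ht : jacobiSn (l1 / l2) (phaseArg l2 c n t) ≠ 0) :
    periodicU l1 l2 c n t / periodicV l1 l2 c n t =
      -(1 + |l1 / l2| * jacobiSn (l1 / l2) (phaseArg l2 c n t) ^ 2 +
        jacobiCn (l1 / l2) (phaseArg l2 c n t) * jacobiDn (l1 / l2) (phaseArg l2 c n t)) / 2 := by
  have h2 := (ne_zero_of_div_neg hk).2
  rw [periodicU, periodicV]
  field_simp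
  ring

/-- The product over one period is constant: both `u₀ / v₀` and `u₁ / v₁` are given by `κ sn²` and
`cn dn`, and `(1 + κ sn²)² - (cn dn)² = (1 + κ)² sn²` with `κ = |k|`. -/
theorem periodicU_mul_div_periodicV_mul (hc : IsPhase (l1 / l2) a c) (n : ℤ) (t : ℝ)
    (ht : jacobiSn (l1 / l2) (phaseArg l2 c n t) ≠ 0) :
    periodicU l1 l2 c n t * periodicU l1 l2 c (n + 1) t /
      (periodicV l1 l2 c n t * periodicV l1 l2 c (n + 1) t) =
      (1 + |l1 / l2|) ^ 2 / (4 * |l1 / l2|) := by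
  have hk' := ofReal_abs_ne_zero hk.ne
  have gk : ((|l1 / l2| : ℝ) : ℂ) ^ 2 = ((l1 / l2 : ℝ) : ℂ) ^ 2 := by
    exact_mod_cast sq_abs (l1 / l2)
  have hsq := jacobiCn_mul_jacobiDn_sq hk.ne ht
  obtain ⟨h1, h2⟩ := hc.jacobi_succ_eq hk l2 n t ht
  rw [mul_div_mul_comm, periodicU_div_periodicV hk n t ht,
    periodicU_div_periodicV hk (n + 1) t (hc.jacobiSn_succ_ne_zero hk l2 n t ht), h1, h2]
  rw [← gk] at hsq
  generalize jacobiCn (l1 / l2) (phaseArg l2 c n t) * jacobiDn (l1 / l2) (phaseArg l2 c n t) = P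
    at *
  generalize jacobiSn (l1 / l2) (phaseArg l2 c n t) = S at *
  generalize ((|l1 / l2| : ℝ) : ℂ) = κ at *
  field_simp
  linear_combination (-4) * hsq

theorem periodicU_ne_zero (hc : IsPhase (l1 / l2) a c) (n : ℤ) (t : ℝ)
    (ht : jacobiSn (l1 / l2) (phaseArg l2 c n t) ≠ 0) : periodicU l1 l2 c n t ≠ 0 := by
  intro h
  have h1 := periodicU_mul_div_periodicV_mul hk hc n t ht
  rw [h, zero_mul, zero_div, eq_comm, div_eq_zero_iff] at h1
  have hk' := ofReal_abs_ne_zero hk.ne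
  rcases h1 with h1 | h1
  · have h2 : (1 + |l1 / l2| : ℝ) ≠ 0 := by positivity
    exact pow_ne_zero 2 h2 (by exact_mod_cast h1)
  · exact mul_ne_zero (by norm_num) hk' h1

/-- `u + v` is proportional to `(κ sn² - 1 + cn dn) / sn`, and
`(κ sn² - 1)² - (cn dn)² = (1 - κ)² sn²` with `κ = |k|`. -/
theorem periodicU_add_periodicV_ne_zero (hk1 : l1 / l2 ≠ -1) (n : ℤ) (t : ℝ)
    (ht : jacobiSn (l1 / l2) (phaseArg l2 c n t) ≠ 0) :
    periodicU l1 l2 c n t + periodicV l1 l2 c n t ≠ 0 := by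
  have gk : ((|l1 / l2| : ℝ) : ℂ) ^ 2 = ((l1 / l2 : ℝ) : ℂ) ^ 2 := by
    exact_mod_cast sq_abs (l1 / l2)
  have hsq := jacobiCn_mul_jacobiDn_sq hk.ne ht
  have h2 := (ne_zero_of_div_neg hk).2
  have hκ : (1 - (|l1 / l2| : ℝ) : ℂ) ≠ 0 := by
    have h : (1 - |l1 / l2| : ℝ) ≠ 0 := by
      rw [abs_of_neg hk]; intro h; apply hk1; linarith
    exact_mod_cast h
  intro h0
  rw [periodicU, periodicV] at h0
  rw [← gk] at hsq
  generalize jacobiCn (l1 / l2) (phaseArg l2 c n t) * jacobiDn (l1 / l2) (phaseArg l2 c n t) = P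
    at *
  generalize jacobiSn (l1 / l2) (phaseArg l2 c n t) = S at *
  generalize ((|l1 / l2| : ℝ) : ℂ) = κ at *
  have h1 : κ * S ^ 2 - 1 + P = 0 := by
    field_simp at h0
    refine mul_left_cancel₀ h2 ?_
    linear_combination h0
  refine mul_ne_zero (pow_ne_zero 2 hκ) (pow_ne_zero 2 ht) ?_
  linear_combination (κ * S ^ 2 - 1 - P) * h1 + hsq

end

section

variable {l1 l2 : ℝ} {a : ℂ} {c : ℤ → ℂ} {U : Set ℝ}

theorem IsPhase.jacobiSn_ne_zero (hc : IsPhase (l1 / l2) a c) (hk : l1 / l2 < 0)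
    {t : ℝ} (ht : jacobiSn (l1 / l2) (phaseArg l2 c 0 t) ≠ 0) (n : ℤ) :
    jacobiSn (l1 / l2) (phaseArg l2 c n t) ≠ 0 := by
  obtain ⟨m, rfl | rfl⟩ := Int.even_or_odd' n
  · rw [← zero_add (2 * m), hc.phaseArg_add_two_mul]
    exact ht
  · rw [add_comm, hc.phaseArg_add_two_mul]
    exact hc.jacobiSn_succ_ne_zero hk l2 0 t ht

/-- Half the logarithmic derivative of `1 + κ sn² + cn dn`, with `κ = |k|`, is `u₀ + v₀`. -/
theorem hasDerivAt_half_log (hk : l1 / l2 < 0) (hU : IsOpen U) {ℓ : ℝ → ℂ} (hℓ : ContinuousOn ℓ U)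
    (hexp : ∀ t ∈ U, Complex.exp (ℓ t) =
      1 + |l1 / l2| * jacobiSn (l1 / l2) (phaseArg l2 c 0 t) ^ 2 +
      jacobiCn (l1 / l2) (phaseArg l2 c 0 t) * jacobiDn (l1 / l2) (phaseArg l2 c 0 t))
    {t : ℝ} (ht : t ∈ U) (h0 : jacobiSn (l1 / l2) (phaseArg l2 c 0 t) ≠ 0) :
    HasDerivAt (fun t => ℓ t / 2) (periodicU l1 l2 c 0 t + periodicV l1 l2 c 0 t) t := by
  have gk : ((|l1 / l2| : ℝ) : ℂ) ^ 2 = ((l1 / l2 : ℝ) : ℂ) ^ 2 := by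
    exact_mod_cast sq_abs (l1 / l2)
  have hS : HasDerivAt (fun t => jacobiSn (l1 / l2) (phaseArg l2 c 0 t)) _ t :=
    hasDerivAt_jacobiSn hk.ne l2 (c 0) t h0
  have hP : HasDerivAt (fun t => jacobiCn (l1 / l2) (phaseArg l2 c 0 t) *
      jacobiDn (l1 / l2) (phaseArg l2 c 0 t)) _ t :=
    hasDerivAt_jacobiCn_mul_jacobiDn hk.ne l2 (c 0) t h0
  have hsq := jacobiCn_mul_jacobiDn_sq hk.ne h0
  have hE := (((hS.pow 2).const_mul ((|l1 / l2| : ℝ) : ℂ)).const_add 1).add hP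
  have hlog := (hasDerivAt_of_exp_eq (hℓ.continuousAt (hU.mem_nhds ht))
    (Filter.eventually_of_mem (hU.mem_nhds ht) hexp) hE).div_const 2
  have hne : 1 + |l1 / l2| * jacobiSn (l1 / l2) (phaseArg l2 c 0 t) ^ 2 +
      jacobiCn (l1 / l2) (phaseArg l2 c 0 t) * jacobiDn (l1 / l2) (phaseArg l2 c 0 t) ≠ 0 := by
    rw [← hexp t ht]; exact Complex.exp_ne_zero _
  refine hlog.congr_deriv ?_
  have hpa : (l2 : ℂ) * t + c 0 = phaseArg l2 c 0 t := rfl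
  simp only [hpa, periodicU, periodicV]
  rw [← gk] at hsq ⊢
  clear hS hP hE hlog hpa hexp gk
  generalize jacobiCn (l1 / l2) (phaseArg l2 c 0 t) * jacobiDn (l1 / l2) (phaseArg l2 c 0 t) = P
    at *
  generalize jacobiSn (l1 / l2) (phaseArg l2 c 0 t) = S at *
  generalize ((|l1 / l2| : ℝ) : ℂ) = κ at *
  push_cast
  field_simp
  linear_combination (-l2 : ℂ) * hsq

end

/-- Since a quotient by `0` is `0`, so that `jacobiSn` is `0` at its poles, the hypothesis
`jacobiSn k ϰ ≠ 0` says that `ϰ` is neither a zero nor a pole of `sn`. -/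
theorem mainTheorem6 (l1 l2 l3 l4 k : ℝ) (a : ℂ)
    (h_three : l3 = -l1) (h_four : l4 = -l2) (hk : k = l1 / l2) (hk_neg : k < 0) :
    -- admissible phases exist
    ((k ≠ -1 ∨ Complex.exp (2 * a) ≠ 1) → ∃ c : ℤ → ℂ, IsPhase k a c) ∧
    ∀ c : ℤ → ℂ, IsPhase k a c →
      -- 2-periodicity
      (∀ n t, periodicU l1 l2 c (n + 2) t = periodicU l1 l2 c n t ∧
        periodicV l1 l2 c (n + 2) t = periodicV l1 l2 c n t) ∧
      (∀ n t, jacobiSn k (phaseArg l2 c n t) ≠ 0 →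
        -- the lattice for `u`, `v`
        SolvesRTLAt (periodicU l1 l2 c) (periodicV l1 l2 c) n t ∧
        -- the equations for `γ`, and `u`, `v` in terms of `γ`
        DifferentiableAt ℝ (periodicGamma l1 l2 c n) t ∧
        deriv (periodicGamma l1 l2 c n) t ^ 2 =
          (periodicGamma l1 l2 c n t - l1) * (periodicGamma l1 l2 c n t - l2) *
            (periodicGamma l1 l2 c n t - l3) * (periodicGamma l1 l2 c n t - l4) ∧
        periodicGamma l1 l2 c (n + 1) t = -(l1 * l2) / periodicGamma l1 l2 c n t ∧
        periodicU l1 l2 c n t =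
          -(1 / 2) * (periodicGamma l1 l2 c n t -
            deriv (periodicGamma l1 l2 c n) t / periodicGamma l1 l2 c n t -
            l1 * l2 / periodicGamma l1 l2 c n t) + (l1 + l2 + l3 + l4) / 4 ∧
        periodicV l1 l2 c n t = -(l1 * l2) / periodicGamma l1 l2 c n t) ∧
      -- the explicit `x_n`; `ℓ` and `m` are continuous branches of the two logarithms
      ∀ (h : ℝ) (C : ℂ) (U : Set ℝ) (ℓ m : ℝ → ℂ) (x : ℤ → ℝ → ℂ),
        0 < h → k ≠ -1 → IsOpen U →
        (∀ t ∈ U, jacobiSn k (phaseArg l2 c 0 t) ≠ 0) →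
        ContinuousOn ℓ U → ContinuousOn m U →
        (∀ t ∈ U, Complex.exp (ℓ t) = 1 + |k| * jacobiSn k (phaseArg l2 c 0 t) ^ 2 +
          jacobiCn k (phaseArg l2 c 0 t) * jacobiDn k (phaseArg l2 c 0 t)) →
        (∀ t ∈ U, Complex.exp (m t) = periodicU l1 l2 c 0 t / periodicV l1 l2 c 0 t) →
        (∀ t ∈ U, x 0 t = -t / h + C + ℓ t / 2) →
        (∀ n : ℤ, ∀ t ∈ U, x (2 * n) t = x 0 t - n *
          (Complex.log (periodicU l1 l2 c 0 t * periodicU l1 l2 c 1 t /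
            (periodicV l1 l2 c 0 t * periodicV l1 l2 c 1 t)) + 4 * Real.log (1 / h))) →
        (∀ n : ℤ, ∀ t ∈ U, x (2 * n + 1) t = x (2 * n) t - (m t + 2 * Real.log (1 / h))) →
        ∀ n : ℤ, ∀ t ∈ U,
          Complex.exp (x n t - x (n + 1) t) =
            periodicU l1 l2 c n t / periodicV l1 l2 c n t * (1 / (h : ℂ) ^ 2) ∧
          HasDerivAt (x n) (periodicU l1 l2 c n t + periodicV l1 l2 c n t - 1 / h) t ∧
          SubstitutionAt h x (periodicU l1 l2 c) (periodicV l1 l2 c) n t ∧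
          SolvesRuijsenaarsTodaAt h x n t := by
  subst hk h_three h_four
  refine ⟨exists_isPhase hk_neg a, fun c hc => ⟨fun n t => ?_, fun n t ht => ?_, ?_⟩⟩
  · have h1 := congrFun (hc.periodicU_add_two_mul n 1) t
    have h2 := congrFun (hc.periodicV_add_two_mul n 1) t
    rw [mul_one] at h1 h2
    exact ⟨h1, h2⟩
  · refine ⟨hc.solvesRTLAt hk_neg n t ht, (hasDerivAt_periodicGamma hk_neg n t ht).differentiableAt,
      deriv_periodicGamma_sq hk_neg n t ht, periodicGamma_succ hk_neg hc n t ht, ?_,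
      periodicV_eq_div_periodicGamma hk_neg n t⟩
    rw [periodicU_eq_periodicGamma hk_neg n t ht]
    push_cast
    ring
  · intro h C U ℓ m x hh hk1 hU h0 hℓ hm hexpℓ hexpm hx0 hxe hxo
    have hS : ∀ n : ℤ, ∀ t ∈ U, jacobiSn (l1 / l2) (phaseArg l2 c n t) ≠ 0 := fun n t ht =>
      hc.jacobiSn_ne_zero hk_neg (h0 t ht) n
    have hlat : ∀ n, ∀ t ∈ U, SolvesRTLAt (periodicU l1 l2 c) (periodicV l1 l2 c) n t :=
      fun n t ht => hc.solvesRTLAt hk_neg n t (hS n t ht)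
    have hu0 : ∀ n, ∀ t ∈ U, periodicU l1 l2 c n t ≠ 0 := fun n t ht =>
      periodicU_ne_zero hk_neg hc n t (hS n t ht)
    have hv0 : ∀ n, ∀ t ∈ U, periodicV l1 l2 c n t ≠ 0 := fun n t ht =>
      periodicV_ne_zero hk_neg n t (hS n t ht)
    have hUe : ∀ n, periodicU l1 l2 c (2 * n) = periodicU l1 l2 c 0 := fun n => by
      rw [← zero_add (2 * n), hc.periodicU_add_two_mul]
    have hUo : ∀ n, periodicU l1 l2 c (2 * n + 1) = periodicU l1 l2 c 1 := fun n => by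
      rw [add_comm, hc.periodicU_add_two_mul]
    have hVe : ∀ n, periodicV l1 l2 c (2 * n) = periodicV l1 l2 c 0 := fun n => by
      rw [← zero_add (2 * n), hc.periodicV_add_two_mul]
    have hVo : ∀ n, periodicV l1 l2 c (2 * n + 1) = periodicV l1 l2 c 1 := fun n => by
      rw [add_comm, hc.periodicV_add_two_mul]
    have hh' : (h : ℂ) ≠ 0 := Complex.ofReal_ne_zero.2 hh.ne'
    have hlogh : Complex.exp (2 * Real.log (1 / h)) = 1 / (h : ℂ) ^ 2 := by
      rw [two_mul, Complex.exp_add, ← Complex.ofReal_exp, Real.exp_log (by positivity)]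
      push_cast
      field_simp
    have hexp : ∀ n, ∀ t ∈ U, Complex.exp (x n t - x (n + 1) t) =
        periodicU l1 l2 c n t / periodicV l1 l2 c n t * (1 / (h : ℂ) ^ 2) := by
      intro n t ht
      have hu := hu0 0 t ht
      have hv := hv0 0 t ht
      have hu1 := hu0 1 t ht
      have hv1 := hv0 1 t ht
      obtain ⟨j, rfl | rfl⟩ := Int.even_or_odd' n
      · rw [hxo j t ht, sub_sub_cancel, Complex.exp_add, hexpm t ht, hlogh, hUe, hVe]
      · rw [show 2 * j + 1 + 1 = 2 * (j + 1) by ring, hxo j t ht, hxe j t ht, hxe (j + 1) t ht,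
          hUo, hVo]
        set L := Complex.log (periodicU l1 l2 c 0 t * periodicU l1 l2 c 1 t /
          (periodicV l1 l2 c 0 t * periodicV l1 l2 c 1 t)) with hL
        have hL' : Complex.exp L = _ := Complex.exp_log
          (div_ne_zero (mul_ne_zero hu hu1) (mul_ne_zero hv hv1))
        rw [show x 0 t - j * (L + 4 * Real.log (1 / h)) - (m t + 2 * Real.log (1 / h)) -
            (x 0 t - ((j + 1 : ℤ) : ℂ) * (L + 4 * Real.log (1 / h))) =
            L - m t + 2 * Real.log (1 / h) by push_cast; ring,
          Complex.exp_add, Complex.exp_sub, hL', hexpm t ht, hlogh]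
        field_simp
    have hx0' : ∀ t ∈ U, HasDerivAt (x 0)
        (periodicU l1 l2 c 0 t + periodicV l1 l2 c 0 t - 1 / h) t := by
      intro t ht
      have hlin : HasDerivAt (fun t : ℝ => -(t : ℂ) / h + C) (-1 / h) t :=
        (((hasDerivAt_id t).ofReal_comp.neg).div_const _).add_const _
      have hd := hlin.add (hasDerivAt_half_log hk_neg hU hℓ hexpℓ ht (h0 t ht))
      refine (hd.congr_of_eventuallyEq
        (Filter.eventually_of_mem (hU.mem_nhds ht) hx0)).congr_deriv ?_
      ring
    -- as `u₋₁ = u₁`, the lattice gives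
    -- `(u₀ / v₀)' / (u₀ / v₀) = (u₁ - u₁ + v₀ - v₁) - (u₁ - u₀)`
    have hm' : ∀ t ∈ U, HasDerivAt m (periodicU l1 l2 c 0 t + periodicV l1 l2 c 0 t -
        (periodicU l1 l2 c 1 t + periodicV l1 l2 c 1 t)) t := by
      intro t ht
      have hu := hu0 0 t ht
      have hv := hv0 0 t ht
      have hprev : periodicU l1 l2 c (0 - 1) = periodicU l1 l2 c 1 := by
        rw [show (0 - 1 : ℤ) = 2 * (-1) + 1 by norm_num, hUo]
      obtain ⟨hdu, hdv⟩ := hlat 0 t ht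
      rw [hprev, zero_add] at hdu
      rw [hprev] at hdv
      have hd : HasDerivAt (fun t => periodicU l1 l2 c 0 t / periodicV l1 l2 c 0 t) _ t :=
        hdu.div hdv hv
      refine (hasDerivAt_of_exp_eq (hm.continuousAt (hU.mem_nhds ht))
        (Filter.eventually_of_mem (hU.mem_nhds ht) hexpm) hd).congr_deriv ?_
      field_simp
      ring
    have hxe' : ∀ n, ∀ t ∈ U, HasDerivAt (x (2 * n))
        (periodicU l1 l2 c 0 t + periodicV l1 l2 c 0 t - 1 / h) t := by
      intro n t ht
      set q : ℂ := (1 + ((|l1 / l2| : ℝ) : ℂ)) ^ 2 / (4 * ((|l1 / l2| : ℝ) : ℂ)) with hq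
      have heq : ∀ s ∈ U, x (2 * n) s = x 0 s - n * (Complex.log q + 4 * Real.log (1 / h)) := by
        intro s hs
        have hs' := periodicU_mul_div_periodicV_mul hk_neg hc 0 s (h0 s hs)
        rw [zero_add] at hs'
        rw [hxe n s hs, hs']
      exact ((hx0' t ht).sub_const _).congr_of_eventuallyEq
        (Filter.eventually_of_mem (hU.mem_nhds ht) heq)
    have hx' : ∀ n, ∀ t ∈ U, HasDerivAt (x n)
        (periodicU l1 l2 c n t + periodicV l1 l2 c n t - 1 / h) t := by
      intro n t ht
      obtain ⟨j, rfl | rfl⟩ := Int.even_or_odd' n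
      · rw [hUe, hVe]
        exact hxe' j t ht
      · rw [hUo, hVo]
        refine (((hxe' j t ht).sub ((hm' t ht).add_const _)).congr_of_eventuallyEq
          (Filter.eventually_of_mem (hU.mem_nhds ht) (hxo j))).congr_deriv ?_
        ring
    intro n t ht
    exact ⟨hexp n t ht, hx' n t ht, solvesRuijsenaarsTodaAt_of_solvesRTLAt hh hU hlat hv0
      (fun n t ht => periodicU_add_periodicV_ne_zero hk_neg hk1 n t (hS n t ht)) hexp hx' n ht⟩
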